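/- **Setting.** A tensor network is a hypergraph $G=(V,E)$ whose vertices are tensors and whose hyperedges $e$ are dimensions with integer sizes $s(e)\ge 1$; an *uncontracted* hyperedge is one with a dangling end, and a contracted one is adjacent to at least two tensors. Put $w(e)=\log s(e)$. For disjoint $A,B\subseteq V$ let $E(A,B)$ be the set of hyperedges adjacent to both $A$ and $B$, let $E(A)$ consist of $E(A,V\setminus A)$ and the uncontracted hyperedges adjacent only to $A$, and let $\mathrm{cut}(A)=w(E(A))$, $\mathrm{cut}(A,B)=w(E(A,B))$. Contracting the outputs of $A$ and $B$ costs $\exp(\mathrm{cut}(A)+\mathrm{cut}(B)-\mathrm{cut}(A,B))$ and *contracts dimensions of total size* $\prod_{e\in E(A,B)\setminus E(A\cup B)}s(e)$. A contraction tree is a rooted binary tree whose leaves are the tensors, each occurring once; its cost is the sum of the costs of its contractions. The data are a tensor network $G_D$ on $V_D$, $N=|V_D|$, a set $\bar E$ of uncontracted hyperedges *to be sketched*, each adjacent to exactly one tensor, and a contraction tree $T_0$ of $G_D$. An embedding $G_E$ is a tensor network on $N_E$ tensors $V_E$ that is a graph (each uncontracted edge is adjacent to one tensor and each contracted edge to two),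 together with an attachment of each $e\in\bar E$ to one tensor of $V_E$; in the overall network $G=(G_D,G_E)$ the edge $e$ connects its data tensor with that embedding tensor. A contraction tree $T_B$ of $G$ is *constrained on* $T_0$ if for each contraction $(A,B)$ of $T_0$ it has a contraction $(\hat A,\hat B)$ with $\hat A\cap V_D=A$ and $\hat B\cap V_D=B$ (contractions being unordered pairs). Fix constants $0<c_0\le c_1\le c_2$. For $\epsilon>0$ and $0<\delta<1$ put $K=\log(1/\delta)/\epsilon^2$. An embedding belongs to $\mathcal G^{(\epsilon,\delta)}$ if * its tensors can be ordered so that for each tensor the product of the sizes of its output dimensions and of its dimensions shared with later tensors is at least $c_0N_EK$, and * it has exactly one output dimension (uncontracted edge not in $\bar E$), whose size, the sketch size, lies between $c_1N_EK$ and $c_2N_EK$. The *tree embedding* of sketch size $m$ for $T_0$ has one tensor $z_W$ for each vertex $W$ of $T_0$: an embedding matrix $z_{\{v\}}$ for each data tensor $v$, to which the sketched edge of $v$ is attached, and one tensor $z_{U\cup V}$ for each contraction $(U,V)$ of $T_0$. For each vertex $W$ of $T_0$ it has one edge of size $m$ from $z_W$ to $z_{W'}$, where $W'$ is the parent of $W$;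 for the root this edge is the output. Its sketching contraction tree contracts each $v$ with $z_{\{v\}}$ and replaces each contraction $(U,V)$ of $T_0$ by $((\hat U,\hat V),z_{U\cup V})$, where $\hat U,\hat V$ are the already sketched $U,V$. **Theorem.** There is a constant $C>0$, depending only on $c_0,c_1,c_2$, such that the following holds for all such data, all $\epsilon>0$ and $0<\delta<1$, and all integers $m$ with $c_1(2N-1)K\le m\le c_2(2N-1)K$. Suppose that each edge to be sketched has size greater than $m$, that each data tensor is adjacent to an edge to be sketched, and that each contraction in $T_0$ contracts dimensions of total size at least $m$. Then: 1. the tree embedding of sketch size $m$ has $2N-1$ tensors, its contracted edges form a tree without parallel edges, and it belongs to $\mathcal G^{(\epsilon,\delta)}$ with sketch size $m$; its sketching contraction tree is a contraction tree of the overall network constrained on $T_0$; 2. the cost of its sketching contraction tree is at most $C$ times the cost of $T_B$, for every embedding $G_E\in\mathcal G^{(\epsilon,\delta)}$ whose sketch size is at least $c_1NK$ (in particular, every one with sketch size $m$) and every contraction tree $T_B$ of $(G_D,G_E)$ constrained on $T_0$. Thus sketching with the tree embedding attains, up to a constant factor, the minimum of the contraction cost over all these embeddings and all contraction trees constrained on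 $T_0$. -/

import Mathlib

/-- A tensor diagram `G = (V, E, w)`: an undirected hypergraph whose vertices are tensors and whose
hyperedges are dimensions. `ends e` is the set of tensors having the dimension `e`;
`uncontracted` is the set of hyperedges that have a dangling end; `size e` is the size of `e`. -/
structure TensorNetwork (V E : Type*) where
  ends : E → Finset V
  uncontracted : Finset E
  size : E → ℕ

namespace TensorNetwork

/-- Sizes are positive, every hyperedge is adjacent to a tensor, and a hyperedge
without dangling end is adjacent to at least two tensors. -/
structure IsProper {V E : Type*} (G : TensorNetwork V E) : Prop where
  size_pos : ∀ e, 1 ≤ G.size e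
  ends_nonempty : ∀ e, (G.ends e).Nonempty
  two_le_of_contracted : ∀ e, e ∉ G.uncontracted → 2 ≤ (G.ends e).card

/-- All hyperedges are edges: an uncontracted one is adjacent to one vertex, a contracted one
to two. Sizes are positive. -/
structure IsGraph {V E : Type*} (G : TensorNetwork V E) : Prop where
  size_pos : ∀ e, 1 ≤ G.size e
  card_uncontracted : ∀ e, e ∈ G.uncontracted → (G.ends e).card = 1
  card_contracted : ∀ e, e ∉ G.uncontracted → (G.ends e).card = 2

variable {V E : Type*} [Fintype V] [DecidableEq V] [Fintype E] [DecidableEq E]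

/-- `w(e)`, the natural logarithm of the size of `e`. -/
noncomputable def weight (G : TensorNetwork V E) (e : E) : ℝ := Real.log (G.size e)

/-- `E(A, B)`: hyperedges adjacent to both `A` and `B`. -/
def edgesBetween (G : TensorNetwork V E) (A B : Finset V) : Finset E :=
  Finset.univ.filter fun e => (G.ends e ∩ A).Nonempty ∧ (G.ends e ∩ B).Nonempty

/-- `E(A, *)`: uncontracted hyperedges adjacent only to `A`. -/
def edgesDangling (G : TensorNetwork V E) (A : Finset V) : Finset E :=
  G.uncontracted.filter fun e => G.ends e ⊆ A

/-- `E(A) = E(A, V \ A) ∪ E(A, *)`: the dimensions of the contraction output of `A`. -/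
def edgesOut (G : TensorNetwork V E) (A : Finset V) : Finset E :=
  G.edgesBetween A Aᶜ ∪ G.edgesDangling A

/-- `cut_G(A)`. -/
noncomputable def cut (G : TensorNetwork V E) (A : Finset V) : ℝ :=
  ∑ e ∈ G.edgesOut A, G.weight e

/-- `cut_G(A, B)`. -/
noncomputable def cutBetween (G : TensorNetwork V E) (A B : Finset V) : ℝ :=
  ∑ e ∈ G.edgesBetween A B, G.weight e

/-- Cost of contracting the contraction outputs of `A` and `B` as dense tensors (with classical
matrix multiplication): `exp(cut(A) + cut(B) - cut(A, B))`. -/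
noncomputable def contractionCost (G : TensorNetwork V E) (A B : Finset V) : ℝ :=
  Real.exp (G.cut A + G.cut B - G.cutBetween A B)

/-- Total size of the dimensions that disappear when (the outputs of) `A` and `B` are
contracted: those shared by `A` and `B` that are not dimensions of the output of `A ∪ B`. -/
def contractedSize (G : TensorNetwork V E) (A B : Finset V) : ℕ :=
  ∏ e ∈ G.edgesBetween A B \ G.edgesOut (A ∪ B), G.size e

end TensorNetwork

/-- Rooted binary trees with leaves labelled by tensors. -/
inductive ContractionTree (V : Type*) where
  | leaf (v : V) : ContractionTree V
  | node (l r : ContractionTree V) : ContractionTree V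

namespace ContractionTree

/-- The tensors at the leaves. -/
def leaves {V : Type*} : ContractionTree V → List V
  | leaf v => [v]
  | node l r => l.leaves ++ r.leaves

/-- A tree fully contracts a network on `V` when each tensor is at exactly one leaf; equivalently,
leaves are singletons, the root is `V`, and siblings are disjoint. -/
structure IsFull {V : Type*} (T : ContractionTree V) : Prop where
  nodup : T.leaves.Nodup
  mem_leaves : ∀ v, v ∈ T.leaves

variable {V : Type*} [DecidableEq V]

/-- The subset of `V` represented by the root. -/
def verts : ContractionTree V → Finset V
  | leaf v => {v}
  | node l r => l.verts ∪ r.verts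

/-- The subsets of `V` represented by the vertices of the tree. -/
def nodes : ContractionTree V → Finset (Finset V)
  | leaf v => {{v}}
  | node l r => insert (l.verts ∪ r.verts) (l.nodes ∪ r.nodes)

/-- The contractions `(A, B)` performed by the tree, one for each internal vertex. -/
def contractions : ContractionTree V → List (Finset V × Finset V)
  | leaf _ => []
  | node l r => (l.verts, r.verts) :: (l.contractions ++ r.contractions)

/-- The vertex `X` of the tree is the parent of the vertex `W`. -/
def IsParent (T : ContractionTree V) (X W : Finset V) : Prop :=
  ∃ p ∈ T.contractions, (p.1 = W ∨ p.2 = W) ∧ X = p.1 ∪ p.2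

instance (T : ContractionTree V) (X W : Finset V) : Decidable (T.IsParent X W) := by
  unfold IsParent; infer_instance

/-- The cost of a contraction tree: the sum of the costs of its contractions. -/
noncomputable def cost {E : Type*} [Fintype V] [Fintype E] [DecidableEq E]
    (T : ContractionTree V) (G : TensorNetwork V E) : ℝ :=
  (T.contractions.map fun p => G.contractionCost p.1 p.2).sum

theorem singleton_mem_nodes {v : V} : ∀ {T : ContractionTree V}, v ∈ T.leaves → {v} ∈ T.nodes
  | leaf u, h => by
      simp only [leaves, List.mem_singleton] at h
      simp [nodes, h]
  | node l r, h => by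
      simp only [leaves, List.mem_append] at h
      simp only [nodes, Finset.mem_insert, Finset.mem_union]
      rcases h with h | h
      · exact Or.inr (Or.inl (singleton_mem_nodes h))
      · exact Or.inr (Or.inr (singleton_mem_nodes h))

/-- A contraction tree `TB` of a network on `VD ⊕ VE` (data and embedding tensors) is constrained
on the contraction tree `T₀` of the data: each contraction `(A, B)` of `T₀` is matched by a
contraction `(A', B')` of `TB` with `A' ∩ VD = A` and `B' ∩ VD = B`. Contractions are
unordered pairs. -/
def ConstrainedOn {VD VE : Type*} [DecidableEq VD] [DecidableEq VE]
    (TB : ContractionTree (VD ⊕ VE)) (T₀ : ContractionTree VD) : Prop :=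
  ∀ p ∈ T₀.contractions, ∃ q ∈ TB.contractions,
    (q.1.toLeft = p.1 ∧ q.2.toLeft = p.2) ∨ (q.1.toLeft = p.2 ∧ q.2.toLeft = p.1)

/-- Given a tree on data tensors and an embedding tensor `z W` for each vertex `W` of the tree:
each data tensor `v` is first contracted with `z {v}`, and each contraction `(U, V)` is replaced by
`((U', V'), z (U ∪ V))`, where `U'`, `V'` are the already sketched `U`, `V`. -/
def sketch {VE : Type*} : (T : ContractionTree V) → ((W : Finset V) → W ∈ T.nodes → VE) →
    ContractionTree (V ⊕ VE)
  | leaf v, z => node (leaf (Sum.inl v)) (leaf (Sum.inr (z {v} (by simp [nodes]))))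
  | node l r, z =>
      node
        (node (l.sketch fun W h => z W (by simp [nodes, h]))
          (r.sketch fun W h => z W (by simp [nodes, h])))
        (leaf (Sum.inr (z (l.verts ∪ r.verts) (by simp [nodes]))))

end ContractionTree

/-- The given data: a tensor network `G_D`, its set of (uncontracted) edges to be sketched, each
adjacent to only one tensor, and a contraction tree `T₀` of `G_D`. -/
structure SketchingInput (VD ED : Type*) where
  net : TensorNetwork VD ED
  proper : net.IsProper
  sketched : Finset ED
  sketched_uncontracted : sketched ⊆ net.uncontracted
  card_ends_of_sketched : ∀ e ∈ sketched, (net.ends e).card = 1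
  tree : ContractionTree VD
  tree_full : tree.IsFull

/-- A tensor network embedding for the edges to be sketched. `attach e` is the embedding tensor
to which the sketched edge `e` is connected; `net` has the embedding tensors as vertices and all
other edges of the embedding as edges, so that `net.uncontracted` is the set of output
(row) dimensions. -/
structure Embedding {ED : Type*} (sketched : Finset ED) (VE EE : Type*) where
  attach : {e // e ∈ sketched} → VE
  net : TensorNetwork VE EE

namespace Embedding

variable {ED : Type*} {sketched : Finset ED} {VE EE : Type*}
  [Fintype VE] [DecidableEq VE] [Fintype EE] [DecidableEq EE]

/-- The output sketch size, the product of the sizes of the output dimensions. -/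
def sketchSize (S : Embedding sketched VE EE) : ℕ :=
  ∏ f ∈ S.net.uncontracted, S.net.size f

/-- For an ordering of the embedding tensors: the row size of the matricization of the tensor at
`v` that has the output dimensions and the dimensions connected to later tensors as rows. -/
def rowSize (S : Embedding sketched VE EE) (ord : VE ≃ Fin (Fintype.card VE)) (v : VE) : ℕ :=
  ∏ f ∈ Finset.univ.filter (fun f => v ∈ S.net.ends f ∧
    (f ∈ S.net.uncontracted ∨ ∃ u ∈ S.net.ends f, ord v < ord u)), S.net.size f

/-- The class of embeddings over which one optimizes: graph embeddings with
* a linearization in which each matricized tensor has row size `Ω(N_E log(1/δ)/ε²)`,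
  with constant `c₀`;
* only one output dimension, of size `Θ(N_E log(1/δ)/ε²)`, with constants `c₁` and `c₂`.
Here `N_E` is the number of embedding tensors. -/
structure IsAdmissible (S : Embedding sketched VE EE) (c₀ c₁ c₂ ε δ : ℝ) : Prop where
  graph : S.net.IsGraph
  linearization : ∃ ord : VE ≃ Fin (Fintype.card VE), ∀ v,
    c₀ * (Fintype.card VE * (Real.log (1 / δ) / ε ^ 2)) ≤ S.rowSize ord v
  one_output : S.net.uncontracted.card = 1
  sketchSize_ge : c₁ * (Fintype.card VE * (Real.log (1 / δ) / ε ^ 2)) ≤ S.sketchSize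
  sketchSize_le : S.sketchSize ≤ c₂ * (Fintype.card VE * (Real.log (1 / δ) / ε ^ 2))

/-- The graph on the embedding tensors formed by the contracted edges. -/
def toSimpleGraph (S : Embedding sketched VE EE) : SimpleGraph VE :=
  SimpleGraph.fromRel fun u v =>
    ∃ f, f ∉ S.net.uncontracted ∧ u ∈ S.net.ends f ∧ v ∈ S.net.ends f

/-- Tree tensor network embeddings: the contracted edges form a tree, without parallel edges. -/
structure IsTree (S : Embedding sketched VE EE) : Prop where
  graph : S.net.IsGraph
  tree : S.toSimpleGraph.IsTree
  no_parallel : ∀ f g, f ∉ S.net.uncontracted → g ∉ S.net.uncontracted →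
    S.net.ends f = S.net.ends g → f = g

end Embedding

namespace SketchingInput

variable {VD ED : Type*} [DecidableEq VD]

/-- The overall network `G = (G_D, G_E)`: each sketched edge now connects its data tensor with the
embedding tensor to which it is attached. -/
def combined {VE EE : Type*} [DecidableEq ED] [DecidableEq VE]
    (P : SketchingInput VD ED) (S : Embedding P.sketched VE EE) :
    TensorNetwork (VD ⊕ VE) (ED ⊕ EE) where
  ends
    | Sum.inl e => (P.net.ends e).disjSum
        (if h : e ∈ P.sketched then {S.attach ⟨e, h⟩} else ∅)
    | Sum.inr f => (∅ : Finset VD).disjSum (S.net.ends f)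
  uncontracted := (P.net.uncontracted \ P.sketched).disjSum S.net.uncontracted
  size := Sum.elim P.net.size S.net.size

/-- The vertices of the data contraction tree; they index the tensors of the tree embedding. -/
abbrev TreeNode (P : SketchingInput VD ED) : Type _ := {W : Finset VD // W ∈ P.tree.nodes}

theorem ends_mem_nodes (P : SketchingInput VD ED) (e : {e // e ∈ P.sketched}) :
    P.net.ends e.1 ∈ P.tree.nodes := by
  obtain ⟨v, hv⟩ := Finset.card_eq_one.1 (P.card_ends_of_sketched e.1 e.2)
  rw [hv]
  exact ContractionTree.singleton_mem_nodes (P.tree_full.mem_leaves v)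

/-- The tree embedding with sketch size `m`. It has a tensor for each data tensor `v`
(the vertex `{v}` of `T₀`), to which the sketched edge of `v` is attached, and a tensor for each
contraction of `T₀` (the vertex `U ∪ V` for the contraction `(U, V)`). For each vertex `W` of `T₀`
it has an edge of size `m`, also named `W`, from the tensor at `W` to the tensor at the parent
of `W`; for the root this edge is the output. -/
def treeEmbedding (P : SketchingInput VD ED) (m : ℕ) :
    Embedding P.sketched P.TreeNode P.TreeNode where
  attach e := ⟨P.net.ends e.1, P.ends_mem_nodes e⟩
  net :=
    { ends := fun W => Finset.univ.filter fun X => X = W ∨ P.tree.IsParent X.1 W.1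
      uncontracted := Finset.univ.filter fun W => W.1 = P.tree.verts
      size := fun _ => m }

/-- The contraction tree that sketches with the tree embedding: each data tensor is contracted
with its embedding matrix, and each contraction `(U, V)` of `T₀` becomes `((U', V'), z)` for the
sketched `U'`, `V'` and the embedding tensor `z` of that contraction. -/
def treeSketch (P : SketchingInput VD ED) : ContractionTree (VD ⊕ P.TreeNode) :=
  P.tree.sketch fun W h => ⟨W, h⟩

end SketchingInput

/-!
A contraction of the overall network involves all row dimensions of the last tensor of either
operand, when the data tensors are ordered before the embedding tensors. If all these row sizes are
at least `b`, then a contraction matching the contraction `(A, B)` of `T₀` costs at least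
`b² · u(A, B)`, where `u(A, B)` is the total size of the dimensions of `A` and `B` that are not
sketched, and the first contraction involving a data tensor `v` costs at least `b` times the size
of `v`. For the tree embedding the same contractions cost at most `m² · u(A, B)` and `m` times the
size of `v`. Contracting further with the tensor at `A ∪ B` involves a third edge of size `m`, which
is paid for by the dimensions of size at least `m` that have been contracted. Finally `m ≤ κ b` for
`κ = 2 c₂² / (c₀ c₁)`, since the sketch size bounds the number of embedding tensors from below.
-/

namespace ContractionTree

section Nodes

variable {V : Type*} [DecidableEq V] {T l r : ContractionTree V} {W X Y : Finset V}
  {p q : Finset V × Finset V}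

theorem mem_nodes_node :
    W ∈ (node l r).nodes ↔ W = l.verts ∪ r.verts ∨ W ∈ l.nodes ∨ W ∈ r.nodes := by
  simp only [nodes, Finset.mem_insert, Finset.mem_union]

theorem mem_contractions_node : p ∈ (node l r).contractions ↔
    p = (l.verts, r.verts) ∨ p ∈ l.contractions ∨ p ∈ r.contractions := by
  simp only [contractions, List.mem_cons, List.mem_append]

theorem mem_verts {v : V} : v ∈ T.verts ↔ v ∈ T.leaves := by
  induction T with
  | leaf u => simp [verts, leaves]
  | node l r hl hr => simp [verts, leaves, hl, hr]

theorem nodup_leaves_node : (node l r).leaves.Nodup ↔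
    l.leaves.Nodup ∧ r.leaves.Nodup ∧ Disjoint l.verts r.verts := by
  rw [leaves, List.nodup_append', List.disjoint_left, Finset.disjoint_left]
  simp only [mem_verts]

theorem verts_mem_nodes (T : ContractionTree V) : T.verts ∈ T.nodes := by
  cases T <;> simp [verts, nodes]

theorem verts_nonempty (T : ContractionTree V) : T.verts.Nonempty := by
  induction T with
  | leaf u => exact Finset.singleton_nonempty u
  | node l r hl _ => exact hl.mono Finset.subset_union_left

theorem subset_verts_of_mem_nodes (h : W ∈ T.nodes) : W ⊆ T.verts := by
  induction T with
  | leaf u => exact (Finset.mem_singleton.1 h).le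
  | node l r hl hr =>
    rcases mem_nodes_node.1 h with rfl | h | h
    · rfl
    · exact (hl h).trans Finset.subset_union_left
    · exact (hr h).trans Finset.subset_union_right

theorem nonempty_of_mem_nodes (h : W ∈ T.nodes) : W.Nonempty := by
  induction T with
  | leaf u => exact Finset.mem_singleton.1 h ▸ Finset.singleton_nonempty u
  | node l r hl hr =>
    rcases mem_nodes_node.1 h with rfl | h | h
    · exact (node l r).verts_nonempty
    · exact hl h
    · exact hr h

theorem mem_nodes_of_mem_contractions (h : p ∈ T.contractions) :
    p.1 ∈ T.nodes ∧ p.2 ∈ T.nodes ∧ p.1 ∪ p.2 ∈ T.nodes := by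
  induction T with
  | leaf u => simp [contractions] at h
  | node l r hl hr =>
    simp only [mem_nodes_node]
    rcases mem_contractions_node.1 h with rfl | h | h
    · simp [verts_mem_nodes]
    · simp [hl h]
    · simp [hr h]

theorem nonempty_of_mem_contractions (h : p ∈ T.contractions) : p.1.Nonempty ∧ p.2.Nonempty :=
  ⟨nonempty_of_mem_nodes (mem_nodes_of_mem_contractions h).1,
    nonempty_of_mem_nodes (mem_nodes_of_mem_contractions h).2.1⟩

theorem disjoint_of_mem_contractions (hT : T.leaves.Nodup) (h : p ∈ T.contractions) :
    Disjoint p.1 p.2 := by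
  induction T with
  | leaf u => simp [contractions] at h
  | node l r hl hr =>
    obtain ⟨hnl, hnr, hd⟩ := nodup_leaves_node.1 hT
    rcases mem_contractions_node.1 h with rfl | h | h
    · exact hd
    · exact hl hnl h
    · exact hr hnr h

theorem mem_nodes_left_iff (hd : Disjoint l.verts r.verts) :
    W ∈ l.nodes ↔ W ∈ (node l r).nodes ∧ W ⊆ l.verts := by
  refine ⟨fun h => ⟨mem_nodes_node.2 (.inr (.inl h)), subset_verts_of_mem_nodes h⟩, ?_⟩
  rintro ⟨h, hWl⟩
  rcases mem_nodes_node.1 h with rfl | h | h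
  · exact absurd (hd.eq_bot_of_ge (Finset.union_subset_iff.1 hWl).2) r.verts_nonempty.ne_empty
  · exact h
  · exact absurd (Finset.disjoint_self_iff_empty W |>.1
      (hd.mono hWl (subset_verts_of_mem_nodes h))) (nonempty_of_mem_nodes h).ne_empty

theorem mem_nodes_right_iff (hd : Disjoint l.verts r.verts) :
    W ∈ r.nodes ↔ W ∈ (node l r).nodes ∧ W ⊆ r.verts := by
  rw [mem_nodes_left_iff hd.symm, mem_nodes_node, mem_nodes_node, Finset.union_comm,
    or_comm (a := W ∈ r.nodes)]

theorem verts_notMem_nodes_left (hd : Disjoint l.verts r.verts) :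
    l.verts ∪ r.verts ∉ l.nodes := fun h =>
  r.verts_nonempty.ne_empty
    (hd.eq_bot_of_ge (Finset.union_subset_iff.1 (subset_verts_of_mem_nodes h)).2)

theorem verts_notMem_nodes_right (hd : Disjoint l.verts r.verts) :
    l.verts ∪ r.verts ∉ r.nodes :=
  Finset.union_comm l.verts r.verts ▸ verts_notMem_nodes_left hd.symm

theorem disjoint_nodes (hd : Disjoint l.verts r.verts) : Disjoint l.nodes r.nodes :=
  Finset.disjoint_left.2 fun _ hl hr => (nonempty_of_mem_nodes hl).ne_empty
    (Finset.disjoint_self_iff_empty _ |>.1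
      (hd.mono (subset_verts_of_mem_nodes hl) (subset_verts_of_mem_nodes hr)))

theorem nodes_laminar (hT : T.leaves.Nodup) (hX : X ∈ T.nodes) (hY : Y ∈ T.nodes) :
    X ⊆ Y ∨ Y ⊆ X ∨ Disjoint X Y := by
  induction T with
  | leaf u => exact .inl (by rw [Finset.mem_singleton.1 hX, Finset.mem_singleton.1 hY])
  | node l r hl hr =>
    obtain ⟨hnl, hnr, hd⟩ := nodup_leaves_node.1 hT
    rcases mem_nodes_node.1 hX with rfl | hXl | hXr
    · exact .inr (.inl (subset_verts_of_mem_nodes hY))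
    · rcases mem_nodes_node.1 hY with rfl | hYl | hYr
      · exact .inl (subset_verts_of_mem_nodes hX)
      · exact hl hnl hXl hYl
      · exact .inr (.inr
          (hd.mono (subset_verts_of_mem_nodes hXl) (subset_verts_of_mem_nodes hYr)))
    · rcases mem_nodes_node.1 hY with rfl | hYl | hYr
      · exact .inl (subset_verts_of_mem_nodes hX)
      · exact .inr (.inr
          (hd.symm.mono (subset_verts_of_mem_nodes hXr) (subset_verts_of_mem_nodes hYl)))
      · exact hr hnr hXr hYr

theorem subset_fst_or_subset_snd (hT : T.leaves.Nodup) (hp : p ∈ T.contractions)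
    (hW : W ∈ T.nodes) (h : W ⊂ p.1 ∪ p.2) : W ⊆ p.1 ∨ W ⊆ p.2 := by
  obtain ⟨hp₁, hp₂, -⟩ := mem_nodes_of_mem_contractions hp
  rcases nodes_laminar hT hW hp₁ with h₁ | h₁ | h₁
  · exact .inl h₁
  · rcases nodes_laminar hT hW hp₂ with h₂ | h₂ | h₂
    · exact .inr h₂
    · exact absurd (Finset.union_subset h₁ h₂) h.2
    · exact .inl (h₂.left_le_of_le_sup_right h.1)
  · exact .inr (h₁.left_le_of_le_sup_left h.1)

theorem IsParent.mem_nodes (h : T.IsParent X W) : X ∈ T.nodes := by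
  obtain ⟨p, hp, -, rfl⟩ := h
  exact (mem_nodes_of_mem_contractions hp).2.2

theorem IsParent.ssubset (hT : T.leaves.Nodup) (h : T.IsParent X W) : W ⊂ X := by
  obtain ⟨p, hp, h, rfl⟩ := h
  have hd := disjoint_of_mem_contractions hT hp
  obtain ⟨hne₁, hne₂⟩ := nonempty_of_mem_contractions hp
  rcases h with rfl | rfl
  · exact ⟨Finset.subset_union_left, fun h =>
      hne₂.ne_empty (hd.eq_bot_of_ge (Finset.union_subset_iff.1 h).2)⟩
  · exact ⟨Finset.subset_union_right, fun h =>
      hne₁.ne_empty (hd.eq_bot_of_le (Finset.union_subset_iff.1 h).1)⟩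

theorem not_isParent_verts (hT : T.leaves.Nodup) : ¬ T.IsParent X T.verts := fun h =>
  (h.ssubset hT).2 (subset_verts_of_mem_nodes h.mem_nodes)

theorem IsParent.subset_of_ssubset (hT : T.leaves.Nodup) (h : T.IsParent X W)
    (hY : Y ∈ T.nodes) (hWY : W ⊂ Y) : X ⊆ Y := by
  have hXY := nodes_laminar hT h.mem_nodes hY
  have hWX := h.ssubset hT
  obtain ⟨p, hp, hpW, rfl⟩ := h
  by_contra hnot
  have hd := disjoint_of_mem_contractions hT hp
  obtain ⟨hne₁, hne₂⟩ := nonempty_of_mem_contractions hp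
  rcases hXY.resolve_left hnot with hYX | hXY
  · rcases subset_fst_or_subset_snd hT hp hY ⟨hYX, hnot⟩ with hY | hY <;>
      rcases hpW with rfl | rfl
    · exact hWY.2 hY
    · exact hne₂.ne_empty (hd.eq_bot_of_ge (hWY.1.trans hY))
    · exact hne₁.ne_empty (hd.eq_bot_of_le (hWY.1.trans hY))
    · exact hWY.2 hY
  · have hW : W = ∅ := (Finset.disjoint_self_iff_empty W).1 (hXY.mono hWX.1 hWY.1)
    rcases hpW with rfl | rfl
    · exact hne₁.ne_empty hW
    · exact hne₂.ne_empty hW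

theorem IsParent.unique (hT : T.leaves.Nodup) (hX : T.IsParent X W) (hY : T.IsParent Y W) :
    X = Y :=
  (hX.subset_of_ssubset hT hY.mem_nodes (hY.ssubset hT)).antisymm
    (hY.subset_of_ssubset hT hX.mem_nodes (hX.ssubset hT))

theorem IsParent.eq_fst_or_eq_snd (hT : T.leaves.Nodup) (hp : p ∈ T.contractions)
    (h : T.IsParent (p.1 ∪ p.2) W) : W = p.1 ∨ W = p.2 := by
  have hlt := h.ssubset hT
  obtain ⟨hp₁, hp₂, -⟩ := mem_nodes_of_mem_contractions hp
  have hW : W ∈ T.nodes := by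
    obtain ⟨q, hq, rfl | rfl, -⟩ := h
    · exact (mem_nodes_of_mem_contractions hq).1
    · exact (mem_nodes_of_mem_contractions hq).2.1
  refine (subset_fst_or_subset_snd hT hp hW hlt).imp (fun hW₁ => ?_) fun hW₂ => ?_
  · by_contra hne
    exact (IsParent.ssubset hT ⟨p, hp, .inl rfl, rfl⟩).2
      (h.subset_of_ssubset hT hp₁ (hW₁.ssubset_of_ne hne))
  · by_contra hne
    exact (IsParent.ssubset hT ⟨p, hp, .inr rfl, rfl⟩).2
      (h.subset_of_ssubset hT hp₂ (hW₂.ssubset_of_ne hne))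

theorem exists_isParent (hW : W ∈ T.nodes) (hne : W ≠ T.verts) : ∃ X, T.IsParent X W := by
  suffices ∃ p ∈ T.contractions, p.1 = W ∨ p.2 = W by
    obtain ⟨p, hp, h⟩ := this
    exact ⟨p.1 ∪ p.2, p, hp, h, rfl⟩
  induction T with
  | leaf u => exact absurd (Finset.mem_singleton.1 hW) hne
  | node l r hl hr =>
    rcases mem_nodes_node.1 hW with rfl | h | h
    · exact absurd rfl hne
    · by_cases hroot : W = l.verts
      · exact ⟨_, mem_contractions_node.2 (.inl rfl), .inl hroot.symm⟩
      · obtain ⟨p, hp, hpW⟩ := hl h hroot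
        exact ⟨p, mem_contractions_node.2 (.inr (.inl hp)), hpW⟩
    · by_cases hroot : W = r.verts
      · exact ⟨_, mem_contractions_node.2 (.inl rfl), .inr hroot.symm⟩
      · obtain ⟨p, hp, hpW⟩ := hr h hroot
        exact ⟨p, mem_contractions_node.2 (.inr (.inr hp)), hpW⟩

theorem nodup_map_union_contractions (hT : T.leaves.Nodup) :
    (T.contractions.map fun p => p.1 ∪ p.2).Nodup := by
  have mem_nodes {T : ContractionTree V} {W : Finset V} :
      W ∈ T.contractions.map (fun p => p.1 ∪ p.2) → W ∈ T.nodes := by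
    simp only [List.mem_map]
    rintro ⟨p, hp, rfl⟩
    exact (mem_nodes_of_mem_contractions hp).2.2
  induction T with
  | leaf u => exact List.nodup_nil
  | node l r hl hr =>
    obtain ⟨hnl, hnr, hd⟩ := nodup_leaves_node.1 hT
    rw [contractions, List.map_cons, List.map_append, List.nodup_cons, List.mem_append,
      List.nodup_append']
    refine ⟨?_, hl hnl, hr hnr, fun W hWl hWr =>
      Finset.disjoint_left.1 (disjoint_nodes hd) (mem_nodes hWl) (mem_nodes hWr)⟩
    rintro (h | h)
    · exact verts_notMem_nodes_left hd (mem_nodes h)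
    · exact verts_notMem_nodes_right hd (mem_nodes h)

theorem card_nodes_add_one (hT : T.leaves.Nodup) : T.nodes.card + 1 = 2 * T.leaves.length := by
  induction T with
  | leaf u => simp only [nodes, leaves, Finset.card_singleton, List.length_singleton]
  | node l r hl hr =>
    obtain ⟨hnl, hnr, hd⟩ := nodup_leaves_node.1 hT
    have hroot : l.verts ∪ r.verts ∉ l.nodes ∪ r.nodes := fun h =>
      (Finset.mem_union.1 h).elim (verts_notMem_nodes_left hd) (verts_notMem_nodes_right hd)
    rw [nodes, Finset.card_insert_of_notMem hroot, Finset.card_union_of_disjoint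
      (disjoint_nodes hd), leaves, List.length_append]
    linarith [hl hnl, hr hnr]

theorem IsFull.card_nodes_add_one [Fintype V] (hT : T.IsFull) :
    T.nodes.card + 1 = 2 * Fintype.card V := by
  rw [ContractionTree.card_nodes_add_one hT.nodup, ← List.toFinset_card_of_nodup hT.nodup,
    Finset.eq_univ_iff_forall.2 fun v => List.mem_toFinset.2 (hT.mem_leaves v), Finset.card_univ]

end Nodes

section Cost

variable {V E : Type*} [Fintype V] [DecidableEq V] [Fintype E] [DecidableEq E]
  {T : ContractionTree V} {G : TensorNetwork V E}

theorem cost_eq_sum_contractions (hT : T.leaves.Nodup) :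
    T.cost G = ∑ p ∈ T.contractions.toFinset, G.contractionCost p.1 p.2 :=
  (List.sum_toFinset _ (nodup_map_union_contractions hT).of_map).symm

theorem sum_contractionCost_le_cost {ι : Type*} (hT : T.leaves.Nodup) {s : Finset ι}
    {q : ι → Finset V × Finset V} (hq : ∀ i ∈ s, q i ∈ T.contractions) (hinj : Set.InjOn q s) :
    ∑ i ∈ s, G.contractionCost (q i).1 (q i).2 ≤ T.cost G := by
  rw [cost_eq_sum_contractions hT,
    ← Finset.sum_image (f := fun p => G.contractionCost p.1 p.2) hinj]
  refine Finset.sum_le_sum_of_subset_of_nonneg (fun p hp => ?_) fun p _ _ => (Real.exp_pos _).le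
  obtain ⟨i, hi, rfl⟩ := Finset.mem_image.1 hp
  exact List.mem_toFinset.2 (hq i hi)

-- A contraction has two operands, so it accounts for at most two leaves.
theorem sum_leaves_le_two_mul_cost {ι : Type*} (hT : T.leaves.Nodup) {s : Finset ι} {u : ι → V}
    (hu : Function.Injective u) {g : ι → ℝ} (hg : ∀ i ∈ s, ∃ p ∈ T.contractions,
      (p.1 = {u i} ∨ p.2 = {u i}) ∧ g i ≤ G.contractionCost p.1 p.2) :
    ∑ i ∈ s, g i ≤ 2 * T.cost G := by
  choose! q hq hqu hgq using hg
  have hfst : ∑ i ∈ s with (q i).1 = {u i}, g i ≤ T.cost G :=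
    (Finset.sum_le_sum fun i hi => hgq i (Finset.mem_filter.1 hi).1).trans <|
      sum_contractionCost_le_cost hT (fun i hi => hq i (Finset.mem_filter.1 hi).1)
        fun i hi j hj h => hu <| Finset.singleton_injective <|
          ((Finset.mem_filter.1 hi).2.symm.trans (congrArg Prod.fst h)).trans
            (Finset.mem_filter.1 hj).2
  have hsnd : ∑ i ∈ s with ¬ (q i).1 = {u i}, g i ≤ T.cost G := by
    have hsnd_eq {i : ι} (hi : i ∈ s.filter fun i => ¬ (q i).1 = {u i}) : (q i).2 = {u i} :=
      (hqu i (Finset.mem_filter.1 hi).1).resolve_left (Finset.mem_filter.1 hi).2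
    exact (Finset.sum_le_sum fun i hi => hgq i (Finset.mem_filter.1 hi).1).trans <|
      sum_contractionCost_le_cost hT (fun i hi => hq i (Finset.mem_filter.1 hi).1)
        fun i hi j hj h => hu <| Finset.singleton_injective <|
          ((hsnd_eq hi).symm.trans (congrArg Prod.snd h)).trans (hsnd_eq hj)
  linarith [Finset.sum_filter_add_sum_filter_not s (fun i => (q i).1 = {u i}) g]

end Cost

section Sketch

variable {V VE : Type*} [DecidableEq V] {T S : ContractionTree V}

theorem inl_mem_leaves_sketch {z : (W : Finset V) → W ∈ T.nodes → VE} {v : V} :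
    Sum.inl v ∈ (T.sketch z).leaves ↔ v ∈ T.leaves := by
  induction T with
  | leaf u => simp [sketch, leaves]
  | node l r hl hr => simp [sketch, leaves, hl, hr]

theorem inr_mem_leaves_sketch {z : (W : Finset V) → W ∈ T.nodes → VE} {x : VE} :
    Sum.inr x ∈ (T.sketch z).leaves ↔ ∃ W h, z W h = x := by
  induction T with
  | leaf u => simp [sketch, leaves, nodes, eq_comm]
  | node l r hl hr =>
    simp only [sketch, leaves, List.mem_append, List.mem_singleton, Sum.inr.injEq, hl, hr]
    constructor
    · rintro ((⟨W, h, rfl⟩ | ⟨W, h, rfl⟩) | rfl)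
      exacts [⟨W, _, rfl⟩, ⟨W, _, rfl⟩, ⟨_, _, rfl⟩]
    · rintro ⟨W, h, rfl⟩
      rcases mem_nodes_node.1 h with rfl | h | h
      exacts [.inr rfl, .inl (.inl ⟨W, h, rfl⟩), .inl (.inr ⟨W, h, rfl⟩)]

theorem nodup_leaves_sketch {z : (W : Finset V) → W ∈ T.nodes → VE} (hT : T.leaves.Nodup)
    (hz : ∀ W h W' h', z W h = z W' h' → W = W') : (T.sketch z).leaves.Nodup := by
  classical
  induction T with
  | leaf u => simp [sketch, leaves]
  | node l r hl hr =>
    obtain ⟨hnl, hnr, hd⟩ := nodup_leaves_node.1 hT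
    rw [sketch, nodup_leaves_node, nodup_leaves_node]
    refine ⟨⟨hl hnl fun W h W' h' => hz _ _ _ _, hr hnr fun W h W' h' => hz _ _ _ _,
      Finset.disjoint_left.2 ?_⟩, List.nodup_singleton _, ?_⟩
    · rintro (v | x) hxl hxr <;> rw [mem_verts] at hxl hxr
      · exact Finset.disjoint_left.1 hd (mem_verts.2 (inl_mem_leaves_sketch.1 hxl))
          (mem_verts.2 (inl_mem_leaves_sketch.1 hxr))
      · obtain ⟨W, h, rfl⟩ := inr_mem_leaves_sketch.1 hxl
        obtain ⟨W', h', he⟩ := inr_mem_leaves_sketch.1 hxr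
        obtain rfl := hz _ _ _ _ he
        exact Finset.disjoint_left.1 (disjoint_nodes hd) h h'
    · rw [verts, Finset.disjoint_singleton_right, mem_verts, leaves, List.mem_append,
        inr_mem_leaves_sketch, inr_mem_leaves_sketch]
      rintro (⟨W, h, he⟩ | ⟨W, h, he⟩) <;> obtain rfl := hz _ _ _ _ he
      · exact verts_notMem_nodes_left hd h
      · exact verts_notMem_nodes_right hd h

theorem toLeft_verts_sketch [DecidableEq VE] {z : (W : Finset V) → W ∈ T.nodes → VE} :
    (T.sketch z).verts.toLeft = T.verts := by
  ext v
  rw [Finset.mem_toLeft, mem_verts, inl_mem_leaves_sketch, mem_verts]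

theorem constrainedOn_sketch [DecidableEq VE] {z : (W : Finset V) → W ∈ T.nodes → VE} :
    (T.sketch z).ConstrainedOn T := by
  intro p hp
  induction T with
  | leaf u => cases hp
  | node l r hl hr =>
    simp only [sketch, mem_contractions_node]
    rcases mem_contractions_node.1 hp with rfl | hp | hp
    · exact ⟨_, .inr (.inl (.inl rfl)), .inl ⟨toLeft_verts_sketch, toLeft_verts_sketch⟩⟩
    · obtain ⟨q, hq, h⟩ := hl (z := fun W h => z W (mem_nodes_node.2 (.inr (.inl h)))) hp
      exact ⟨q, .inr (.inl (.inr (.inl hq))), h⟩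
    · obtain ⟨q, hq, h⟩ := hr (z := fun W h => z W (mem_nodes_node.2 (.inr (.inr h)))) hp
      exact ⟨q, .inr (.inl (.inr (.inr hq))), h⟩

/-- The tensors that the sketching contraction tree has contracted once it has sketched the
vertex `W` of `T`: the data tensors of `W` and the embedding tensors of all vertices below. -/
def sketchedVerts (T : ContractionTree V) (W : Finset V) : Finset (V ⊕ {X // X ∈ T.nodes}) :=
  W.disjSum (W.powerset.subtype (· ∈ T.nodes))

/-- The singleton of the embedding tensor at the vertex `W` of `T`, and `∅` if `W` is not a
vertex. -/
def nodeTensor (T : ContractionTree V) (W : Finset V) : Finset (V ⊕ {X // X ∈ T.nodes}) :=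
  (∅ : Finset V).disjSum (({W} : Finset (Finset V)).subtype (· ∈ T.nodes))

theorem inl_mem_sketchedVerts {v : V} {W : Finset V} :
    Sum.inl v ∈ T.sketchedVerts W ↔ v ∈ W := Finset.inl_mem_disjSum

theorem inr_mem_sketchedVerts {X : {X // X ∈ T.nodes}} {W : Finset V} :
    Sum.inr X ∈ T.sketchedVerts W ↔ X.1 ⊆ W := by
  rw [sketchedVerts, Finset.inr_mem_disjSum, Finset.mem_subtype, Finset.mem_powerset]

theorem inl_notMem_nodeTensor {v : V} {W : Finset V} : Sum.inl v ∉ T.nodeTensor W := by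
  rw [nodeTensor, Finset.inl_mem_disjSum]
  exact Finset.notMem_empty v

theorem inr_mem_nodeTensor {X : {X // X ∈ T.nodes}} {W : Finset V} :
    Sum.inr X ∈ T.nodeTensor W ↔ X.1 = W := by
  rw [nodeTensor, Finset.inr_mem_disjSum, Finset.mem_subtype, Finset.mem_singleton]

theorem nodeTensor_of_mem {W : Finset V} (hW : W ∈ T.nodes) :
    T.nodeTensor W = {Sum.inr ⟨W, hW⟩} := by
  ext (v | X)
  · simp [inl_notMem_nodeTensor]
  · simp [inr_mem_nodeTensor, Subtype.ext_iff]

theorem disjoint_sketchedVerts {W W' : Finset V} (h : Disjoint W W') :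
    Disjoint (T.sketchedVerts W) (T.sketchedVerts W') := by
  rw [Finset.disjoint_left]
  rintro (v | X) hW hW'
  · rw [inl_mem_sketchedVerts] at hW hW'
    exact Finset.disjoint_left.1 h hW hW'
  · rw [inr_mem_sketchedVerts] at hW hW'
    exact (nonempty_of_mem_nodes X.2).ne_empty (Finset.subset_empty.1 (h hW hW'))

theorem disjoint_sketchedVerts_nodeTensor {W W' : Finset V} (h : ¬ W' ⊆ W) :
    Disjoint (T.sketchedVerts W) (T.nodeTensor W') := by
  rw [Finset.disjoint_right]
  rintro (v | X) hX
  · exact absurd hX inl_notMem_nodeTensor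
  · rwa [inr_mem_sketchedVerts, inr_mem_nodeTensor.1 hX]

theorem verts_sketch (hS : ∀ W, W ∈ S.nodes ↔ W ∈ T.nodes ∧ W ⊆ S.verts) :
    (S.sketch fun W h => (⟨W, ((hS W).1 h).1⟩ : {X // X ∈ T.nodes})).verts =
      T.sketchedVerts S.verts := by
  ext (v | X)
  · rw [mem_verts, inl_mem_leaves_sketch, inl_mem_sketchedVerts, mem_verts]
  · rw [mem_verts, inr_mem_leaves_sketch, inr_mem_sketchedVerts]
    exact ⟨fun ⟨W, h, hX⟩ => hX ▸ subset_verts_of_mem_nodes h,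
      fun h => ⟨X, (hS X).2 ⟨X.2, h⟩, rfl⟩⟩

theorem cost_sketch_subtree {E : Type*} [Fintype V] [Fintype E] [DecidableEq E]
    (G : TensorNetwork (V ⊕ {X // X ∈ T.nodes}) E) (hn : S.leaves.Nodup)
    (hS : ∀ W, W ∈ S.nodes ↔ W ∈ T.nodes ∧ W ⊆ S.verts) :
    (S.sketch fun W h => (⟨W, ((hS W).1 h).1⟩ : {X // X ∈ T.nodes})).cost G =
      (S.leaves.map fun v => G.contractionCost {Sum.inl v} (T.nodeTensor {v})).sum +
      (S.contractions.map fun p =>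
        G.contractionCost (T.sketchedVerts p.1) (T.sketchedVerts p.2) +
        G.contractionCost (T.sketchedVerts p.1 ∪ T.sketchedVerts p.2)
          (T.nodeTensor (p.1 ∪ p.2))).sum := by
  induction S with
  | leaf u =>
    have hu : {u} ∈ T.nodes := ((hS {u}).1 (Finset.mem_singleton_self _)).1
    simp [sketch, cost, contractions, leaves, verts, nodeTensor_of_mem hu]
  | node l r hl hr =>
    obtain ⟨hnl, hnr, hd⟩ := nodup_leaves_node.1 hn
    have hl_nodes (W : Finset V) : W ∈ l.nodes ↔ W ∈ T.nodes ∧ W ⊆ l.verts := by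
      rw [mem_nodes_left_iff hd, hS, and_assoc, and_congr_right_iff, and_iff_right_iff_imp]
      exact fun _ h => h.trans Finset.subset_union_left
    have hr_nodes (W : Finset V) : W ∈ r.nodes ↔ W ∈ T.nodes ∧ W ⊆ r.verts := by
      rw [mem_nodes_right_iff hd, hS, and_assoc, and_congr_right_iff, and_iff_right_iff_imp]
      exact fun _ h => h.trans Finset.subset_union_right
    have hroot : l.verts ∪ r.verts ∈ T.nodes := ((hS _).1 (verts_mem_nodes (node l r))).1
    have hl_cost := hl hnl hl_nodes
    have hr_cost := hr hnr hr_nodes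
    simp only [cost] at hl_cost hr_cost
    simp only [sketch, cost, contractions, leaves, List.map_cons, List.map_append, List.sum_cons,
      List.sum_append, List.map_nil, List.sum_nil, hl_cost, hr_cost, verts_sketch hl_nodes,
      verts_sketch hr_nodes, verts, nodeTensor_of_mem hroot]
    ring

theorem cost_sketch {E : Type*} [Fintype V] [Fintype E] [DecidableEq E]
    (G : TensorNetwork (V ⊕ {X // X ∈ T.nodes}) E) (hT : T.IsFull) :
    (T.sketch fun W h => (⟨W, h⟩ : {X // X ∈ T.nodes})).cost G =
      ∑ v, G.contractionCost {Sum.inl v} (T.nodeTensor {v}) +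
      ∑ p ∈ T.contractions.toFinset,
        (G.contractionCost (T.sketchedVerts p.1) (T.sketchedVerts p.2) +
        G.contractionCost (T.sketchedVerts p.1 ∪ T.sketchedVerts p.2)
          (T.nodeTensor (p.1 ∪ p.2))) := by
  rw [cost_sketch_subtree G hT.nodup fun W => (and_iff_left_of_imp subset_verts_of_mem_nodes).symm,
    List.sum_toFinset _ (nodup_map_union_contractions hT.nodup).of_map,
    ← List.sum_toFinset _ hT.nodup,
    Finset.eq_univ_iff_forall.2 fun v => List.mem_toFinset.2 (hT.mem_leaves v)]

end Sketch

end ContractionTree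

namespace TensorNetwork

section RowDims

/-- The hyperedge `e` is an edge: it has one end if it is uncontracted and two otherwise. -/
structure IsEdge {V E : Type*} (G : TensorNetwork V E) (e : E) : Prop where
  card_uncontracted : e ∈ G.uncontracted → (G.ends e).card = 1
  card_contracted : e ∉ G.uncontracted → (G.ends e).card = 2

variable {V E ι : Type*} [DecidableEq V] [DecidableEq E] [LinearOrder ι] {G : TensorNetwork V E}
  {D : Finset E} {rank : V → ι} {e : E} {u v : V}

/-- The dimensions among `D` that are rows of the matricization of the tensor `u`, for an ordering
of the tensors by `rank`: the uncontracted ones and those shared with a tensor of higher rank. -/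
def rowDims (G : TensorNetwork V E) (D : Finset E) (rank : V → ι) (u : V) : Finset E :=
  D.filter fun e => u ∈ G.ends e ∧ (e ∈ G.uncontracted ∨ ∃ w ∈ G.ends e, rank u < rank w)

theorem mem_rowDims : e ∈ G.rowDims D rank u ↔
    e ∈ D ∧ u ∈ G.ends e ∧ (e ∈ G.uncontracted ∨ ∃ w ∈ G.ends e, rank u < rank w) :=
  Finset.mem_filter

theorem rank_lt_of_mem_rowDims (hD : ∀ e ∈ D, G.IsEdge e) (he : e ∈ G.rowDims D rank u)
    (hv : v ∈ G.ends e) (hne : u ≠ v) : rank u < rank v := by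
  obtain ⟨heD, hu, hrow⟩ := mem_rowDims.1 he
  by_cases hunc : e ∈ G.uncontracted
  · exact absurd (Finset.card_le_one.1 ((hD e heD).card_uncontracted hunc).le u hu v hv) hne
  · obtain ⟨w, hw, hlt⟩ := hrow.resolve_left hunc
    have hends : {u, v} = G.ends e :=
      Finset.eq_of_subset_of_card_le (Finset.insert_subset hu (Finset.singleton_subset_iff.2 hv))
        (by rw [(hD e heD).card_contracted hunc, Finset.card_pair hne])
    rw [← hends, Finset.mem_insert, Finset.mem_singleton] at hw
    obtain rfl | rfl := hw
    · exact absurd hlt (lt_irrefl _)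
    · exact hlt

theorem disjoint_rowDims (hD : ∀ e ∈ D, G.IsEdge e) (hne : u ≠ v) :
    Disjoint (G.rowDims D rank u) (G.rowDims D rank v) :=
  Finset.disjoint_left.2 fun _ hu hv =>
    (rank_lt_of_mem_rowDims hD hu (mem_rowDims.1 hv).2.1 hne).asymm
      (rank_lt_of_mem_rowDims hD hv (mem_rowDims.1 hu).2.1 hne.symm)

end RowDims

section Cost

variable {V E : Type*} [DecidableEq V] [Fintype E] {G : TensorNetwork V E} {A B : Finset V} {e : E}

theorem mem_edgesBetween :
    e ∈ G.edgesBetween A B ↔ (∃ v ∈ A, v ∈ G.ends e) ∧ ∃ v ∈ B, v ∈ G.ends e := by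
  simp only [edgesBetween, Finset.mem_filter, Finset.mem_univ, true_and, Finset.Nonempty,
    Finset.mem_inter, and_comm]

variable [Fintype V] [DecidableEq E]

theorem IsProper.mem_edgesOut (hG : G.IsProper) : e ∈ G.edgesOut A ↔
    (∃ v ∈ A, v ∈ G.ends e) ∧ (e ∈ G.uncontracted ∨ ∃ v ∉ A, v ∈ G.ends e) := by
  rw [edgesOut, Finset.mem_union, mem_edgesBetween, edgesDangling, Finset.mem_filter]
  simp only [Finset.mem_compl]
  constructor
  · rintro (⟨hA, hAc⟩ | ⟨he, hA⟩)
    · exact ⟨hA, .inr hAc⟩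
    · obtain ⟨v, hv⟩ := hG.ends_nonempty e
      exact ⟨⟨v, hA hv, hv⟩, .inl he⟩
  · rintro ⟨hA, he | hAc⟩
    · by_cases h : G.ends e ⊆ A
      · exact .inr ⟨he, h⟩
      · obtain ⟨v, hv, hvA⟩ := Finset.not_subset.1 h
        exact .inl ⟨hA, v, hvA, hv⟩
    · exact .inl ⟨hA, hAc⟩

theorem contractionCost_comm (A B : Finset V) :
    G.contractionCost A B = G.contractionCost B A := by
  have hbetween : G.edgesBetween A B = G.edgesBetween B A := by
    ext e
    rw [mem_edgesBetween, mem_edgesBetween, and_comm]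
  rw [contractionCost, contractionCost, cutBetween, cutBetween, hbetween, add_comm (G.cut A)]

theorem IsProper.mem_edgesOut_singleton (hG : G.IsProper) {v : V} :
    e ∈ G.edgesOut {v} ↔ v ∈ G.ends e := by
  rw [hG.mem_edgesOut]
  simp only [Finset.mem_singleton, exists_eq_left, and_iff_left_iff_imp]
  intro _
  by_cases he : e ∈ G.uncontracted
  · exact .inl he
  · obtain ⟨u, hu, huv⟩ := Finset.exists_mem_ne (hG.two_le_of_contracted e he) v
    exact .inr ⟨u, huv, hu⟩

theorem IsProper.edgesOut_union_subset (hG : G.IsProper) :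
    G.edgesOut (A ∪ B) ⊆ G.edgesOut A ∪ G.edgesOut B := by
  intro e he
  simp only [Finset.mem_union, hG.mem_edgesOut, not_or] at he ⊢
  obtain ⟨⟨v, hv, hve⟩, hout⟩ := he
  exact hv.imp (fun hv => ⟨⟨v, hv, hve⟩, hout.imp_right fun ⟨u, hu, hue⟩ => ⟨u, hu.1, hue⟩⟩)
    fun hv => ⟨⟨v, hv, hve⟩, hout.imp_right fun ⟨u, hu, hue⟩ => ⟨u, hu.2, hue⟩⟩

theorem IsProper.edgesBetween_eq_inter (hG : G.IsProper) (h : Disjoint A B) :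
    G.edgesBetween A B = G.edgesOut A ∩ G.edgesOut B := by
  ext e
  rw [Finset.mem_inter, hG.mem_edgesOut, hG.mem_edgesOut, mem_edgesBetween]
  constructor
  · rintro ⟨⟨v, hv, hve⟩, u, hu, hue⟩
    exact ⟨⟨⟨v, hv, hve⟩, .inr ⟨u, Finset.disjoint_right.1 h hu, hue⟩⟩,
      ⟨u, hu, hue⟩, .inr ⟨v, Finset.disjoint_left.1 h hv, hve⟩⟩
  · rintro ⟨⟨hA, -⟩, hB, -⟩
    exact ⟨hA, hB⟩

theorem IsProper.contractionCost_eq_prod (hG : G.IsProper) (h : Disjoint A B) :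
    G.contractionCost A B = ∏ e ∈ G.edgesOut A ∪ G.edgesOut B, (G.size e : ℝ) := by
  have hsum : G.cut A + G.cut B - G.cutBetween A B =
      ∑ e ∈ G.edgesOut A ∪ G.edgesOut B, G.weight e := by
    rw [cut, cut, cutBetween, hG.edgesBetween_eq_inter h, ← Finset.sum_union_inter,
      add_sub_cancel_right]
  rw [contractionCost, hsum, Real.exp_sum]
  exact Finset.prod_congr rfl fun e _ => Real.exp_log (by exact_mod_cast hG.size_pos e)

theorem IsProper.contractionCost_le_prod (hG : G.IsProper) (h : Disjoint A B) {F : Finset E}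
    (hF : G.edgesOut A ∪ G.edgesOut B ⊆ F) :
    G.contractionCost A B ≤ (∏ e ∈ F, G.size e : ℕ) := by
  rw [hG.contractionCost_eq_prod h, ← Nat.cast_prod, Nat.cast_le]
  exact Finset.prod_le_prod_of_subset_of_one_le' hF fun e _ _ => hG.size_pos e

theorem IsProper.prod_le_contractionCost (hG : G.IsProper) (h : Disjoint A B) {F : Finset E}
    (hF : F ⊆ G.edgesOut A ∪ G.edgesOut B) :
    (∏ e ∈ F, G.size e : ℕ) ≤ G.contractionCost A B := by
  rw [hG.contractionCost_eq_prod h, ← Nat.cast_prod, Nat.cast_le]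
  exact Finset.prod_le_prod_of_subset_of_one_le' hF fun e _ _ => hG.size_pos e

variable {ι : Type*} [LinearOrder ι] {D : Finset E} {rank : V → ι} {v : V} {b : ℝ}

-- The last tensor of `A` has only tensors outside of `A` after it.
theorem IsProper.exists_rowDims_subset_edgesOut (hG : G.IsProper) (D : Finset E) (rank : V → ι)
    (hA : A.Nonempty) : ∃ u ∈ A, G.rowDims D rank u ⊆ G.edgesOut A := by
  obtain ⟨u, hu, hmax⟩ := A.exists_max_image rank hA
  refine ⟨u, hu, fun e he => ?_⟩
  obtain ⟨-, hue, hrow⟩ := mem_rowDims.1 he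
  exact hG.mem_edgesOut.2 ⟨⟨u, hu, hue⟩, hrow.imp_right fun ⟨w, hw, hlt⟩ =>
    ⟨w, fun hwA => (hmax w hwA).not_gt hlt, hw⟩⟩

theorem IsProper.sq_mul_prod_le_contractionCost (hG : G.IsProper) (hD : ∀ e ∈ D, G.IsEdge e)
    (hb : 0 ≤ b) (hrow : ∀ u, b ≤ (∏ e ∈ G.rowDims D rank u, G.size e : ℕ)) (h : Disjoint A B)
    (hA : A.Nonempty) (hB : B.Nonempty) :
    b ^ 2 * (∏ e ∈ (G.edgesOut A ∪ G.edgesOut B) \ D, G.size e : ℕ) ≤ G.contractionCost A B := by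
  obtain ⟨u, hu, hu_sub⟩ := hG.exists_rowDims_subset_edgesOut D rank hA
  obtain ⟨v, hv, hv_sub⟩ := hG.exists_rowDims_subset_edgesOut D rank hB
  have huv := disjoint_rowDims (rank := rank) hD (Finset.disjoint_iff_ne.1 h u hu v hv)
  have hout : Disjoint (G.rowDims D rank u ∪ G.rowDims D rank v)
      ((G.edgesOut A ∪ G.edgesOut B) \ D) :=
    Finset.disjoint_sdiff.mono_left
      (Finset.union_subset (Finset.filter_subset _ _) (Finset.filter_subset _ _))
  calc b ^ 2 * (∏ e ∈ (G.edgesOut A ∪ G.edgesOut B) \ D, G.size e : ℕ)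
      ≤ ((∏ e ∈ G.rowDims D rank u, G.size e : ℕ) * (∏ e ∈ G.rowDims D rank v, G.size e : ℕ)) *
          (∏ e ∈ (G.edgesOut A ∪ G.edgesOut B) \ D, G.size e : ℕ) := by
        rw [sq]
        gcongr
        exacts [hrow u, hrow v]
    _ = (∏ e ∈ (G.rowDims D rank u ∪ G.rowDims D rank v) ∪
          ((G.edgesOut A ∪ G.edgesOut B) \ D), G.size e : ℕ) := by
        rw [Finset.prod_union hout, Finset.prod_union huv, Nat.cast_mul, Nat.cast_mul]
    _ ≤ G.contractionCost A B := hG.prod_le_contractionCost h <|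
        Finset.union_subset (Finset.union_subset_union hu_sub hv_sub) Finset.sdiff_subset

theorem IsProper.mul_prod_le_contractionCost (hG : G.IsProper) (hD : ∀ e ∈ D, G.IsEdge e)
    (hrow : ∀ u, b ≤ (∏ e ∈ G.rowDims D rank u, G.size e : ℕ)) (hv : IsMin (rank v))
    (h : Disjoint {v} B) (hB : B.Nonempty) :
    b * (∏ e ∈ G.edgesOut {v}, G.size e : ℕ) ≤ G.contractionCost {v} B := by
  obtain ⟨u, hu, hu_sub⟩ := hG.exists_rowDims_subset_edgesOut D rank hB
  have hne : u ≠ v := fun huv => Finset.disjoint_singleton_left.1 h (huv ▸ hu)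
  have hdisj : Disjoint (G.rowDims D rank u) (G.edgesOut {v}) :=
    Finset.disjoint_left.2 fun e heu hev => hv.not_lt <|
      rank_lt_of_mem_rowDims hD heu (hG.mem_edgesOut_singleton.1 hev) hne
  calc b * (∏ e ∈ G.edgesOut {v}, G.size e : ℕ)
      ≤ (∏ e ∈ G.rowDims D rank u, G.size e : ℕ) * (∏ e ∈ G.edgesOut {v}, G.size e : ℕ) := by
        gcongr
        exact hrow u
    _ = (∏ e ∈ G.rowDims D rank u ∪ G.edgesOut {v}, G.size e : ℕ) := by
        rw [Finset.prod_union hdisj, Nat.cast_mul]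
    _ ≤ G.contractionCost {v} B := hG.prod_le_contractionCost h <|
        Finset.union_subset (hu_sub.trans Finset.subset_union_right) Finset.subset_union_left

end Cost

end TensorNetwork

theorem exists_strictMono_equiv_fin (α : Type*) [Fintype α] [PartialOrder α] :
    ∃ f : α ≃ Fin (Fintype.card α), StrictMono f := by
  let _ : Fintype (LinearExtension α) := inferInstanceAs (Fintype α)
  let f : LinearExtension α ≃o Fin (Fintype.card α) := (Fintype.orderIsoFinOfCardEq _ rfl).symm
  exact ⟨f.toEquiv, fun a b h => f.strictMono ((toLinearExtension.monotone h.le).lt_of_ne h.ne)⟩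

theorem isTree_of_parent {V : Type*} [Finite V] [PartialOrder V] {G : SimpleGraph V} {root : V}
    {R : V → V → Prop} (hlt : ∀ u v, R u v → u < v) (huniq : ∀ u v w, R u v → R u w → v = w)
    (hex : ∀ u, u ≠ root → ∃ v, R u v) (hroot : ∀ v, ¬ R root v)
    (hadj : ∀ u v, G.Adj u v ↔ R u v ∨ R v u) : G.IsTree := by
  have hreach (u : V) : G.Reachable u root := by
    induction u using WellFoundedGT.induction with
    | _ u ih =>
      by_cases hu : u = root
      · rw [hu]
      · obtain ⟨v, hv⟩ := hex u hu
        exact ((hadj u v).2 (.inl hv)).reachable.trans (ih v (hlt u v hv))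
  have hconn : G.Connected :=
    { preconnected := fun u v => (hreach u).trans (hreach v).symm
      nonempty := ⟨root⟩ }
  choose! parent hparent using hex
  have hedge {u v : V} (h : R u v) : s(u, v) ∈ (fun u => s(u, parent u)) '' {root}ᶜ := by
    have hu : u ≠ root := fun hu => hroot v (hu ▸ h)
    exact ⟨u, hu, congrArg (s(u, ·)) (huniq u _ v (hparent u hu) h)⟩
  have hsub : G.edgeSet ⊆ (fun u => s(u, parent u)) '' {root}ᶜ := by
    intro e
    induction e using Sym2.ind with
    | _ u v =>
      rw [SimpleGraph.mem_edgeSet, hadj]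
      exact fun h => h.elim hedge fun h => Sym2.eq_swap ▸ hedge h
  refine (SimpleGraph.isTree_iff_connected_and_card).2
    ⟨hconn, le_antisymm ?_ hconn.card_vert_le_card_edgeSet_add_one⟩
  calc Nat.card G.edgeSet + 1
      ≤ ({root}ᶜ : Set V).ncard + 1 := by
        gcongr
        exact (Set.ncard_le_ncard hsub).trans Set.ncard_image_le
    _ = Nat.card V := by
        rw [← Set.ncard_add_ncard_compl {root}, Set.ncard_singleton, add_comm]

namespace SketchingInput

open ContractionTree

section TreeEmbedding

variable {VD ED : Type*} [DecidableEq VD] {P : SketchingInput VD ED} {m : ℕ} {W X Y : P.TreeNode}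

theorem coe_attach_treeEmbedding (e : {e // e ∈ P.sketched}) :
    ((P.treeEmbedding m).attach e).1 = P.net.ends e.1 :=
  rfl

theorem mem_ends_treeEmbedding :
    X ∈ (P.treeEmbedding m).net.ends W ↔ X = W ∨ P.tree.IsParent X.1 W.1 := by
  simp only [treeEmbedding, Finset.mem_filter, Finset.mem_univ, true_and]

theorem mem_uncontracted_treeEmbedding :
    W ∈ (P.treeEmbedding m).net.uncontracted ↔ W.1 = P.tree.verts := by
  simp only [treeEmbedding, Finset.mem_filter, Finset.mem_univ, true_and]

theorem uncontracted_treeEmbedding :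
    (P.treeEmbedding m).net.uncontracted = {⟨P.tree.verts, P.tree.verts_mem_nodes⟩} := by
  ext W
  rw [mem_uncontracted_treeEmbedding, Finset.mem_singleton, Subtype.ext_iff]

theorem exists_parent (hW : W.1 ≠ P.tree.verts) : ∃ X : P.TreeNode, P.tree.IsParent X.1 W.1 := by
  obtain ⟨X, hX⟩ := exists_isParent W.2 hW
  exact ⟨⟨X, hX.mem_nodes⟩, hX⟩

theorem isGraph_treeEmbedding (hm : 1 ≤ m) : (P.treeEmbedding m).net.IsGraph where
  size_pos _ := hm
  card_uncontracted W hW := by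
    refine Finset.card_eq_one.2 ⟨W, ?_⟩
    ext X
    rw [mem_ends_treeEmbedding, Finset.mem_singleton, mem_uncontracted_treeEmbedding.1 hW]
    exact or_iff_left (not_isParent_verts P.tree_full.nodup)
  card_contracted W hW := by
    obtain ⟨X, hX⟩ := exists_parent fun h => hW (mem_uncontracted_treeEmbedding.2 h)
    have hWX : W ≠ X := fun h => (hX.ssubset P.tree_full.nodup).ne (congrArg Subtype.val h)
    refine Finset.card_eq_two.2 ⟨W, X, hWX, ?_⟩
    ext Y
    rw [mem_ends_treeEmbedding, Finset.mem_insert, Finset.mem_singleton]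
    exact or_congr_right
      ⟨fun h => Subtype.ext (h.unique P.tree_full.nodup hX), fun h => h ▸ hX⟩

theorem sketchSize_treeEmbedding : (P.treeEmbedding m).sketchSize = m := by
  rw [Embedding.sketchSize, uncontracted_treeEmbedding, Finset.prod_singleton, treeEmbedding]

theorem le_rowSize_treeEmbedding (hm : 1 ≤ m) {ord : P.TreeNode ≃ Fin (Fintype.card P.TreeNode)}
    (hord : StrictMono ord) (W : P.TreeNode) : m ≤ (P.treeEmbedding m).rowSize ord W := by
  refine Finset.single_le_prod' (f := (P.treeEmbedding m).net.size) (a := W) (fun _ _ => hm)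
    (Finset.mem_filter.2 ⟨Finset.mem_univ W, mem_ends_treeEmbedding.2 (.inl rfl), ?_⟩)
  rw [mem_uncontracted_treeEmbedding, or_iff_not_imp_left]
  intro hW
  obtain ⟨X, hX⟩ := exists_parent hW
  exact ⟨X, mem_ends_treeEmbedding.2 (.inr hX), hord (hX.ssubset P.tree_full.nodup)⟩

theorem isAdmissible_treeEmbedding {c₀ c₁ c₂ ε δ : ℝ} (hm : 1 ≤ m) (hc₀₁ : c₀ ≤ c₁)
    (hK : 0 ≤ Real.log (1 / δ) / ε ^ 2)
    (hm_ge : c₁ * (Fintype.card P.TreeNode * (Real.log (1 / δ) / ε ^ 2)) ≤ m)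
    (hm_le : m ≤ c₂ * (Fintype.card P.TreeNode * (Real.log (1 / δ) / ε ^ 2))) :
    (P.treeEmbedding m).IsAdmissible c₀ c₁ c₂ ε δ where
  graph := isGraph_treeEmbedding hm
  linearization := by
    obtain ⟨ord, hord⟩ := exists_strictMono_equiv_fin P.TreeNode
    refine ⟨ord, fun W => ?_⟩
    calc c₀ * (Fintype.card P.TreeNode * (Real.log (1 / δ) / ε ^ 2))
        ≤ c₁ * (Fintype.card P.TreeNode * (Real.log (1 / δ) / ε ^ 2)) := by gcongr
      _ ≤ (m : ℝ) := hm_ge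
      _ ≤ ((P.treeEmbedding m).rowSize ord W : ℝ) := by
        exact_mod_cast le_rowSize_treeEmbedding hm hord W
  one_output := by rw [uncontracted_treeEmbedding, Finset.card_singleton]
  sketchSize_ge := by rwa [sketchSize_treeEmbedding]
  sketchSize_le := by rwa [sketchSize_treeEmbedding]

theorem adj_treeEmbedding : (P.treeEmbedding m).toSimpleGraph.Adj X Y ↔
    P.tree.IsParent Y.1 X.1 ∨ P.tree.IsParent X.1 Y.1 := by
  have hcontracted {X Y : P.TreeNode} (h : P.tree.IsParent Y.1 X.1) :
      X ∉ (P.treeEmbedding m).net.uncontracted := fun hX =>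
    not_isParent_verts P.tree_full.nodup (mem_uncontracted_treeEmbedding.1 hX ▸ h)
  have hend {X Y : P.TreeNode} (hne : X ≠ Y) : (∃ f, f ∉ (P.treeEmbedding m).net.uncontracted ∧
      X ∈ (P.treeEmbedding m).net.ends f ∧ Y ∈ (P.treeEmbedding m).net.ends f) ↔
      P.tree.IsParent Y.1 X.1 ∨ P.tree.IsParent X.1 Y.1 := by
    simp only [mem_ends_treeEmbedding]
    constructor
    · rintro ⟨f, -, rfl | hX, rfl | hY⟩
      · exact absurd rfl hne
      · exact .inl hY
      · exact .inr hX
      · exact absurd (Subtype.ext (hX.unique P.tree_full.nodup hY)) hne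
    · rintro (h | h)
      · exact ⟨X, hcontracted h, .inl rfl, .inr h⟩
      · exact ⟨Y, hcontracted h, .inr h, .inl rfl⟩
  rw [Embedding.toSimpleGraph, SimpleGraph.fromRel_adj]
  constructor
  · rintro ⟨hne, h | h⟩
    · exact (hend hne).1 h
    · exact ((hend hne.symm).1 h).symm
  · intro h
    have hne : X ≠ Y := by
      rintro rfl
      exact h.elim (fun h => (h.ssubset P.tree_full.nodup).ne rfl)
        fun h => (h.ssubset P.tree_full.nodup).ne rfl
    exact ⟨hne, .inl ((hend hne).2 h)⟩

theorem isTree_treeEmbedding (hm : 1 ≤ m) : (P.treeEmbedding m).IsTree where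
  graph := isGraph_treeEmbedding hm
  tree := isTree_of_parent (root := ⟨P.tree.verts, P.tree.verts_mem_nodes⟩)
    (fun _ _ h => h.ssubset P.tree_full.nodup)
    (fun _ _ _ hX hY => Subtype.ext (hX.unique P.tree_full.nodup hY))
    (fun _ hW => exists_parent fun h => hW (Subtype.ext h))
    (fun _ => not_isParent_verts P.tree_full.nodup) fun _ _ => adj_treeEmbedding
  no_parallel W X _ _ h := by
    have hWX := mem_ends_treeEmbedding.1 (h ▸ mem_ends_treeEmbedding.2 (.inl rfl) :
      W ∈ (P.treeEmbedding m).net.ends X)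
    have hXW := mem_ends_treeEmbedding.1 (h ▸ mem_ends_treeEmbedding.2 (.inl rfl) :
      X ∈ (P.treeEmbedding m).net.ends W)
    refine hWX.resolve_right fun hWX => ?_
    have hne := (hWX.ssubset P.tree_full.nodup).ne
    exact (hWX.ssubset P.tree_full.nodup).asymm <|
      (hXW.resolve_left fun h => hne (congrArg Subtype.val h)).ssubset P.tree_full.nodup

theorem isFull_treeSketch : P.treeSketch.IsFull where
  nodup := nodup_leaves_sketch P.tree_full.nodup fun _ _ _ _ h => congrArg Subtype.val h
  mem_leaves := by
    rintro (v | W)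
    · exact inl_mem_leaves_sketch.2 (P.tree_full.mem_leaves v)
    · exact inr_mem_leaves_sketch.2 ⟨W.1, W.2, rfl⟩

variable [Fintype VD]

theorem card_treeNode_add_one : Fintype.card P.TreeNode + 1 = 2 * Fintype.card VD := by
  rw [Fintype.card_coe]
  exact P.tree_full.card_nodes_add_one

theorem cast_card_treeNode : (Fintype.card P.TreeNode : ℝ) = 2 * Fintype.card VD - 1 :=
  eq_sub_of_add_eq (by exact_mod_cast P.card_treeNode_add_one)

end TreeEmbedding

section Combined

variable {VD ED VE EE : Type*} [DecidableEq ED] [DecidableEq VE]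
  {P : SketchingInput VD ED} {S : Embedding P.sketched VE EE} {e : ED} {f : EE} {v : VD} {x : VE}

theorem inl_mem_ends_inl : Sum.inl v ∈ (P.combined S).ends (Sum.inl e) ↔ v ∈ P.net.ends e := by
  simp [combined]

theorem inr_mem_ends_inl :
    Sum.inr x ∈ (P.combined S).ends (Sum.inl e) ↔ ∃ h, S.attach ⟨e, h⟩ = x := by
  by_cases h : e ∈ P.sketched <;> simp [combined, h, eq_comm]

theorem inl_notMem_ends_inr : Sum.inl v ∉ (P.combined S).ends (Sum.inr f) := by
  simp [combined]

theorem inr_mem_ends_inr :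
    Sum.inr x ∈ (P.combined S).ends (Sum.inr f) ↔ x ∈ S.net.ends f := by
  simp [combined]

theorem inl_mem_uncontracted :
    Sum.inl e ∈ (P.combined S).uncontracted ↔ e ∈ P.net.uncontracted ∧ e ∉ P.sketched := by
  simp [combined]

theorem inr_mem_uncontracted :
    Sum.inr f ∈ (P.combined S).uncontracted ↔ f ∈ S.net.uncontracted := by
  simp [combined]

theorem card_ends_inr : ((P.combined S).ends (Sum.inr f)).card = (S.net.ends f).card := by
  simp [combined]

theorem card_ends_inl_of_mem (he : e ∈ P.sketched) :
    ((P.combined S).ends (Sum.inl e)).card = 2 := by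
  simp [combined, he, P.card_ends_of_sketched e he]

theorem prod_size_disjSum {F : Finset ED} {s : Finset EE} :
    ∏ i ∈ F.disjSum s, (P.combined S).size i =
      (∏ e ∈ F, P.net.size e) * ∏ f ∈ s, S.net.size f :=
  Finset.prod_disjSum F s _

theorem isEdge_combined (hS : S.net.IsGraph) (f : EE) : (P.combined S).IsEdge (Sum.inr f) where
  card_uncontracted h :=
    card_ends_inr.trans (hS.card_uncontracted f (inr_mem_uncontracted.1 h))
  card_contracted h :=
    card_ends_inr.trans (hS.card_contracted f fun hf => h (inr_mem_uncontracted.2 hf))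

theorem isEdge_combined_of_mem (he : e ∈ P.sketched) : (P.combined S).IsEdge (Sum.inl e) where
  card_uncontracted h := absurd he (inl_mem_uncontracted.1 h).2
  card_contracted _ := card_ends_inl_of_mem he

theorem isProper_combined (hS : S.net.IsGraph) : (P.combined S).IsProper where
  size_pos := by
    rintro (e | f)
    exacts [P.proper.size_pos e, hS.size_pos f]
  ends_nonempty := by
    rintro (e | f)
    · obtain ⟨v, hv⟩ := P.proper.ends_nonempty e
      exact ⟨_, inl_mem_ends_inl.2 hv⟩
    · rw [← Finset.card_pos]
      by_cases h : Sum.inr f ∈ (P.combined S).uncontracted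
      · exact ((isEdge_combined hS f).card_uncontracted h).symm ▸ one_pos
      · exact ((isEdge_combined hS f).card_contracted h).symm ▸ two_pos
  two_le_of_contracted := by
    rintro (e | f) h
    · by_cases he : e ∈ P.sketched
      · exact (card_ends_inl_of_mem he).ge
      · exact (P.proper.two_le_of_contracted e fun h' =>
          h (inl_mem_uncontracted.2 ⟨h', he⟩)).trans (by simp [combined])
    · exact ((isEdge_combined hS f).card_contracted h).ge

variable [Fintype VD] [DecidableEq VD] [Fintype ED] [Fintype VE] [Fintype EE] [DecidableEq EE]
  {A B : Finset (VD ⊕ VE)}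

theorem inl_mem_edgesOut (hS : S.net.IsGraph) (he : e ∉ P.sketched) :
    Sum.inl e ∈ (P.combined S).edgesOut A ↔ e ∈ P.net.edgesOut A.toLeft := by
  have hend (x : VE) : Sum.inr x ∉ (P.combined S).ends (Sum.inl e) := fun hx =>
    he (inr_mem_ends_inl.1 hx).1
  simp only [(isProper_combined hS).mem_edgesOut, P.proper.mem_edgesOut, Sum.exists,
    inl_mem_ends_inl, hend, and_false, exists_false, or_false, Finset.mem_toLeft,
    inl_mem_uncontracted, he, not_false_eq_true, and_true]

theorem edgesOut_singleton_inl (hS : S.net.IsGraph) :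
    (P.combined S).edgesOut {Sum.inl v} = (P.net.edgesOut {v}).disjSum ∅ := by
  ext (e | f)
  · rw [(isProper_combined hS).mem_edgesOut_singleton, inl_mem_ends_inl, Finset.inl_mem_disjSum,
      P.proper.mem_edgesOut_singleton]
  · simp [(isProper_combined hS).mem_edgesOut_singleton, inl_notMem_ends_inr]

/-- The product of the sizes of the dimensions not to be sketched that occur in the contraction
of the outputs of `A` and `B` in the data network. -/
def unsketchedSize (P : SketchingInput VD ED) (A B : Finset VD) : ℕ :=
  ∏ e ∈ (P.net.edgesOut A ∪ P.net.edgesOut B) \ P.sketched, P.net.size e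

theorem unsketchedSize_comm (A B : Finset VD) :
    P.unsketchedSize A B = P.unsketchedSize B A := by
  rw [unsketchedSize, unsketchedSize, Finset.union_comm]

theorem prod_edgesOut_union_mul_contractedSize_le {A B : Finset VD} (h : Disjoint A B) :
    (∏ e ∈ P.net.edgesOut (A ∪ B) \ P.sketched, P.net.size e) * P.net.contractedSize A B ≤
      P.unsketchedSize A B := by
  have hdisj : Disjoint (P.net.edgesOut (A ∪ B) \ P.sketched)
      (P.net.edgesBetween A B \ P.net.edgesOut (A ∪ B)) :=
    Finset.disjoint_sdiff.mono_left Finset.sdiff_subset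
  have hunsketched : P.net.edgesBetween A B ⊆
      (P.net.edgesOut A ∪ P.net.edgesOut B) \ P.sketched := by
    intro e he
    obtain ⟨⟨u, hu, hue⟩, v, hv, hve⟩ := TensorNetwork.mem_edgesBetween.1 he
    rw [P.proper.edgesBetween_eq_inter h] at he
    refine Finset.mem_sdiff.2 ⟨Finset.mem_union_left _ (Finset.mem_inter.1 he).1, fun hs => ?_⟩
    exact Finset.disjoint_iff_ne.1 h u hu v hv
      (Finset.card_le_one.1 (P.card_ends_of_sketched e hs).le u hue v hve)
  rw [TensorNetwork.contractedSize, ← Finset.prod_union hdisj]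
  exact Finset.prod_le_prod_of_subset_of_one_le'
    (Finset.union_subset
      (Finset.sdiff_subset_sdiff P.proper.edgesOut_union_subset Finset.Subset.rfl)
      (Finset.sdiff_subset.trans hunsketched))
    fun e _ _ => P.proper.size_pos e

theorem prod_edgesOut_union_mul_pow_three_le {A B : Finset VD} {m : ℕ} (h : Disjoint A B)
    (hm : m ≤ P.net.contractedSize A B) :
    (∏ e ∈ P.net.edgesOut (A ∪ B) \ P.sketched, P.net.size e) * m ^ 3 ≤
      m ^ 2 * P.unsketchedSize A B :=
  calc (∏ e ∈ P.net.edgesOut (A ∪ B) \ P.sketched, P.net.size e) * m ^ 3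
      = m ^ 2 * ((∏ e ∈ P.net.edgesOut (A ∪ B) \ P.sketched, P.net.size e) * m) := by ring
    _ ≤ m ^ 2 * ((∏ e ∈ P.net.edgesOut (A ∪ B) \ P.sketched, P.net.size e) *
          P.net.contractedSize A B) := by gcongr
    _ ≤ m ^ 2 * P.unsketchedSize A B := by
        gcongr
        exact prod_edgesOut_union_mul_contractedSize_le h

end Combined

section UpperBound

variable {VD ED : Type*} [Fintype VD] [DecidableEq VD] [Fintype ED] [DecidableEq ED]
  {P : SketchingInput VD ED} {m : ℕ} {e : ED} {v : VD} {W : Finset VD} {X : P.TreeNode}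
  {p : Finset VD × Finset VD}

theorem inl_mem_edgesOut_sketchedVerts (hm : 1 ≤ m)
    (h : Sum.inl e ∈ (P.combined (P.treeEmbedding m)).edgesOut (P.tree.sketchedVerts W)) :
    e ∈ P.net.edgesOut W \ P.sketched := by
  have hG := isGraph_treeEmbedding (P := P) hm
  by_cases he : e ∈ P.sketched
  · obtain ⟨v, hv⟩ := Finset.card_eq_one.1 (P.card_ends_of_sketched e he)
    have hend : ∀ u ∈ (P.combined (P.treeEmbedding m)).ends (Sum.inl e),
        u ∈ P.tree.sketchedVerts W ↔ v ∈ W := by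
      rintro (u | X) hu
      · rw [inl_mem_ends_inl, hv, Finset.mem_singleton] at hu
        rw [inl_mem_sketchedVerts, hu]
      · obtain ⟨_, rfl⟩ := inr_mem_ends_inl.1 hu
        rw [inr_mem_sketchedVerts, coe_attach_treeEmbedding, hv, Finset.singleton_subset_iff]
    obtain ⟨⟨u, hu, hue⟩, hout | ⟨w, hw, hwe⟩⟩ := (isProper_combined hG).mem_edgesOut.1 h
    · exact absurd he (inl_mem_uncontracted.1 hout).2
    · exact absurd ((hend w hwe).2 ((hend u hue).1 hu)) hw
  · rw [inl_mem_edgesOut hG he, sketchedVerts, Finset.toLeft_disjSum] at h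
    exact Finset.mem_sdiff.2 ⟨h, he⟩

theorem inl_mem_edgesOut_sketchedVerts_union {W' : Finset VD} (hm : 1 ≤ m)
    (h : Sum.inl e ∈ (P.combined (P.treeEmbedding m)).edgesOut
      (P.tree.sketchedVerts W ∪ P.tree.sketchedVerts W')) :
    e ∈ P.net.edgesOut (W ∪ W') \ P.sketched := by
  have hG := isGraph_treeEmbedding (P := P) hm
  have he : e ∉ P.sketched :=
    (Finset.mem_union.1 ((isProper_combined hG).edgesOut_union_subset h)).elim
      (fun h => (Finset.mem_sdiff.1 (inl_mem_edgesOut_sketchedVerts hm h)).2)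
      fun h => (Finset.mem_sdiff.1 (inl_mem_edgesOut_sketchedVerts hm h)).2
  rw [inl_mem_edgesOut hG he, Finset.toLeft_union, sketchedVerts, sketchedVerts,
    Finset.toLeft_disjSum, Finset.toLeft_disjSum] at h
  exact Finset.mem_sdiff.2 ⟨h, he⟩

theorem eq_of_inr_mem_edgesOut_sketchedVerts (hm : 1 ≤ m) (hW : W ∈ P.tree.nodes)
    (h : Sum.inr X ∈ (P.combined (P.treeEmbedding m)).edgesOut (P.tree.sketchedVerts W)) :
    X.1 = W := by
  have hT := P.tree_full.nodup
  rw [(isProper_combined (isGraph_treeEmbedding hm)).mem_edgesOut] at h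
  simp only [Sum.exists, inl_notMem_ends_inr, and_false, exists_false, false_or,
    inr_mem_ends_inr, mem_ends_treeEmbedding, inr_mem_sketchedVerts, inr_mem_uncontracted,
    mem_uncontracted_treeEmbedding] at h
  obtain ⟨⟨Y, hYW, hY⟩, hout⟩ := h
  have hXW : X.1 ⊆ W := by
    rcases hY with rfl | hY
    exacts [hYW, (hY.ssubset hT).1.trans hYW]
  by_contra hne
  obtain hroot | ⟨Z, hZW, rfl | hZ⟩ := hout
  · exact hne (hXW.antisymm (hroot ▸ subset_verts_of_mem_nodes hW))
  · exact hZW hXW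
  · exact hZW (hZ.subset_of_ssubset hT hW (hXW.ssubset_of_ne hne))

theorem ends_eq_of_inl_mem_edgesOut_nodeTensor (hm : 1 ≤ m)
    (h : Sum.inl e ∈ (P.combined (P.treeEmbedding m)).edgesOut (P.tree.nodeTensor W)) :
    e ∈ P.sketched ∧ P.net.ends e = W := by
  obtain ⟨⟨v | X, hX, hXe⟩, -⟩ :=
    (isProper_combined (isGraph_treeEmbedding hm)).mem_edgesOut.1 h
  · exact absurd hX inl_notMem_nodeTensor
  · obtain ⟨he, rfl⟩ := inr_mem_ends_inl.1 hXe
    exact ⟨he, inr_mem_nodeTensor.1 hX⟩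

theorem eq_or_isParent_of_inr_mem_edgesOut_nodeTensor (hm : 1 ≤ m)
    (h : Sum.inr X ∈ (P.combined (P.treeEmbedding m)).edgesOut (P.tree.nodeTensor W)) :
    X.1 = W ∨ P.tree.IsParent W X.1 := by
  obtain ⟨⟨v | Y, hY, hYe⟩, -⟩ :=
    (isProper_combined (isGraph_treeEmbedding hm)).mem_edgesOut.1 h
  · exact absurd hY inl_notMem_nodeTensor
  · rw [inr_mem_ends_inr, mem_ends_treeEmbedding] at hYe
    obtain rfl := inr_mem_nodeTensor.1 hY
    exact hYe.imp_left fun h => congrArg Subtype.val h.symm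

theorem contractionCost_treeEmbedding_le (hm : 1 ≤ m) {A B : Finset (VD ⊕ P.TreeNode)}
    (h : Disjoint A B) {F : Finset ED} {s : Finset (Finset VD)}
    (hF : ∀ e, Sum.inl e ∈ (P.combined (P.treeEmbedding m)).edgesOut A ∪
      (P.combined (P.treeEmbedding m)).edgesOut B → e ∈ F)
    (hs : ∀ X, Sum.inr X ∈ (P.combined (P.treeEmbedding m)).edgesOut A ∪
      (P.combined (P.treeEmbedding m)).edgesOut B → X.1 ∈ s) :
    (P.combined (P.treeEmbedding m)).contractionCost A B ≤
      ((∏ e ∈ F, P.net.size e) * m ^ s.card : ℕ) := by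
  have hsub : (P.combined (P.treeEmbedding m)).edgesOut A ∪
      (P.combined (P.treeEmbedding m)).edgesOut B ⊆
      F.disjSum (s.subtype (· ∈ P.tree.nodes)) := by
    rintro (e | X) hX
    · exact Finset.inl_mem_disjSum.2 (hF e hX)
    · exact Finset.inr_mem_disjSum.2 (Finset.mem_subtype.2 (hs X hX))
  refine ((isProper_combined (isGraph_treeEmbedding hm)).contractionCost_le_prod h hsub).trans ?_
  rw [prod_size_disjSum, Nat.cast_le]
  gcongr
  refine (Finset.prod_const m).trans_le (Nat.pow_le_pow_right hm ?_)
  rw [Finset.card_subtype]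
  exact Finset.card_filter_le _ _

theorem contractionCost_leaf_le (hm : 1 ≤ m) (v : VD) :
    (P.combined (P.treeEmbedding m)).contractionCost {Sum.inl v} (P.tree.nodeTensor {v}) ≤
      m * (∏ e ∈ P.net.edgesOut {v}, P.net.size e : ℕ) := by
  refine (contractionCost_treeEmbedding_le hm (F := P.net.edgesOut {v}) (s := {{v}})
    (Finset.disjoint_singleton_left.2 inl_notMem_nodeTensor) (fun e he => ?_)
    fun X hX => ?_).trans_eq ?_
  · rw [edgesOut_singleton_inl (isGraph_treeEmbedding hm), Finset.mem_union,
      Finset.inl_mem_disjSum] at he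
    refine he.elim id fun he => P.proper.mem_edgesOut_singleton.2 ?_
    exact (ends_eq_of_inl_mem_edgesOut_nodeTensor hm he).2 ▸ Finset.mem_singleton_self v
  · rw [edgesOut_singleton_inl (isGraph_treeEmbedding hm), Finset.mem_union,
      Finset.inr_mem_disjSum] at hX
    replace hX := hX.resolve_left (Finset.notMem_empty X)
    refine Finset.mem_singleton.2
      ((eq_or_isParent_of_inr_mem_edgesOut_nodeTensor hm hX).resolve_right fun h => ?_)
    exact (nonempty_of_mem_nodes X.2).ne_empty
      (Finset.ssubset_singleton_iff.1 (h.ssubset P.tree_full.nodup))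
  · rw [Finset.card_singleton, pow_one, mul_comm, Nat.cast_mul]

theorem contractionCost_sketched_le (hm : 1 ≤ m) (hp : p ∈ P.tree.contractions) :
    (P.combined (P.treeEmbedding m)).contractionCost
      (P.tree.sketchedVerts p.1) (P.tree.sketchedVerts p.2) ≤
      (m ^ 2 * P.unsketchedSize p.1 p.2 : ℕ) := by
  obtain ⟨hp₁, hp₂, -⟩ := mem_nodes_of_mem_contractions hp
  refine (contractionCost_treeEmbedding_le hm
    (F := (P.net.edgesOut p.1 ∪ P.net.edgesOut p.2) \ P.sketched) (s := {p.1, p.2})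
    (disjoint_sketchedVerts (disjoint_of_mem_contractions P.tree_full.nodup hp))
    (fun e he => ?_) fun X hX => ?_).trans ?_
  · rw [Finset.union_sdiff_distrib, Finset.mem_union]
    exact (Finset.mem_union.1 he).imp (inl_mem_edgesOut_sketchedVerts hm)
      (inl_mem_edgesOut_sketchedVerts hm)
  · rw [Finset.mem_insert, Finset.mem_singleton]
    exact (Finset.mem_union.1 hX).imp (eq_of_inr_mem_edgesOut_sketchedVerts hm hp₁)
      (eq_of_inr_mem_edgesOut_sketchedVerts hm hp₂)
  · rw [mul_comm, ← unsketchedSize, Nat.cast_le]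
    exact Nat.mul_le_mul_right _ (Nat.pow_le_pow_right hm Finset.card_le_two)

theorem contractionCost_nodeTensor_le (hm : 1 ≤ m) (hp : p ∈ P.tree.contractions)
    (hmp : m ≤ P.net.contractedSize p.1 p.2) :
    (P.combined (P.treeEmbedding m)).contractionCost
      (P.tree.sketchedVerts p.1 ∪ P.tree.sketchedVerts p.2) (P.tree.nodeTensor (p.1 ∪ p.2)) ≤
      (m ^ 2 * P.unsketchedSize p.1 p.2 : ℕ) := by
  have hT := P.tree_full.nodup
  have hd := disjoint_of_mem_contractions hT hp
  obtain ⟨hp₁, hp₂, -⟩ := mem_nodes_of_mem_contractions hp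
  obtain ⟨hne₁, hne₂⟩ := nonempty_of_mem_contractions hp
  have hdisj : Disjoint (P.tree.sketchedVerts p.1 ∪ P.tree.sketchedVerts p.2)
      (P.tree.nodeTensor (p.1 ∪ p.2)) :=
    Finset.disjoint_union_left.2
      ⟨disjoint_sketchedVerts_nodeTensor fun h =>
        hne₂.ne_empty (hd.eq_bot_of_ge (Finset.union_subset_iff.1 h).2),
      disjoint_sketchedVerts_nodeTensor fun h =>
        hne₁.ne_empty (hd.eq_bot_of_le (Finset.union_subset_iff.1 h).1)⟩
  refine (contractionCost_treeEmbedding_le hm (F := P.net.edgesOut (p.1 ∪ p.2) \ P.sketched)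
    (s := {p.1, p.2, p.1 ∪ p.2}) hdisj (fun e he => ?_) fun X hX => ?_).trans ?_
  · rcases Finset.mem_union.1 he with he | he
    · exact inl_mem_edgesOut_sketchedVerts_union hm he
    · obtain ⟨hs, hends⟩ := ends_eq_of_inl_mem_edgesOut_nodeTensor hm he
      have hcard := P.card_ends_of_sketched e hs
      rw [hends, Finset.card_union_of_disjoint hd] at hcard
      exact absurd hcard (by have := hne₁.card_pos; have := hne₂.card_pos; lia)
  · simp only [Finset.mem_insert, Finset.mem_singleton]
    rcases Finset.mem_union.1 hX with hX | hX
    · exact (Finset.mem_union.1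
        ((isProper_combined (isGraph_treeEmbedding hm)).edgesOut_union_subset hX)).imp
        (eq_of_inr_mem_edgesOut_sketchedVerts hm hp₁)
        fun h => .inl (eq_of_inr_mem_edgesOut_sketchedVerts hm hp₂ h)
    · rcases eq_or_isParent_of_inr_mem_edgesOut_nodeTensor hm hX with h | h
      · exact .inr (.inr h)
      · exact (h.eq_fst_or_eq_snd hT hp).imp_right .inl
  · rw [Nat.cast_le]
    exact (Nat.mul_le_mul_left _ (Nat.pow_le_pow_right hm Finset.card_le_three)).trans
      (prod_edgesOut_union_mul_pow_three_le hd hmp)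

theorem cost_treeSketch_le (hm : 1 ≤ m)
    (hmp : ∀ p ∈ P.tree.contractions, m ≤ P.net.contractedSize p.1 p.2) :
    P.treeSketch.cost (P.combined (P.treeEmbedding m)) ≤
      ∑ v, (m : ℝ) * (∏ e ∈ P.net.edgesOut {v}, P.net.size e : ℕ) +
        ∑ p ∈ P.tree.contractions.toFinset, 2 * (m ^ 2 * (P.unsketchedSize p.1 p.2 : ℝ)) := by
  rw [treeSketch, cost_sketch _ P.tree_full]
  gcongr with v _ p hp
  · exact contractionCost_leaf_le hm v
  · rw [List.mem_toFinset] at hp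
    rw [two_mul]
    exact_mod_cast add_le_add (contractionCost_sketched_le hm hp)
      (contractionCost_nodeTensor_le hm hp (hmp p hp))

end UpperBound

section LowerBound

variable {VD ED VE EE : Type*} [DecidableEq VE] [DecidableEq ED] [Fintype EE]
  {P : SketchingInput VD ED} {S : Embedding P.sketched VE EE}

/-- The edges of the overall network incident to an embedding tensor: the sketched edges and the
edges of the embedding. -/
def embeddingEdges (P : SketchingInput VD ED) (EE : Type*) [Fintype EE] : Finset (ED ⊕ EE) :=
  P.sketched.disjSum Finset.univ

theorem isEdge_of_mem_embeddingEdges (hS : S.net.IsGraph) :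
    ∀ i ∈ P.embeddingEdges EE, (P.combined S).IsEdge i := by
  rintro (e | f) h
  · exact isEdge_combined_of_mem (Finset.inl_mem_disjSum.1 h)
  · exact isEdge_combined hS f

/-- The order in which all data tensors come first, followed by the embedding tensors in the
order `ord`. -/
def dataFirst (VD : Type*) {VE : Type*} [Fintype VE] (ord : VE ≃ Fin (Fintype.card VE)) :
    VD ⊕ VE → WithBot (Fin (Fintype.card VE)) :=
  Sum.elim (fun _ => ⊥) fun x => ord x

variable [Fintype VE] [DecidableEq VD] [DecidableEq EE] {ord : VE ≃ Fin (Fintype.card VE)} {b : ℝ}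

theorem le_prod_rowDims (hS : S.net.IsGraph) (hrow : ∀ x, b ≤ S.rowSize ord x)
    (hsize : ∀ e ∈ P.sketched, b ≤ P.net.size e)
    (hdata : ∀ v, ∃ e ∈ P.sketched, v ∈ P.net.ends e) (u : VD ⊕ VE) :
    b ≤ (∏ i ∈ (P.combined S).rowDims (P.embeddingEdges EE) (dataFirst VD ord) u,
      (P.combined S).size i : ℕ) := by
  rcases u with v | x
  · obtain ⟨e, he, hv⟩ := hdata v
    have hmem : Sum.inl e ∈
        (P.combined S).rowDims (P.embeddingEdges EE) (dataFirst VD ord) (Sum.inl v) :=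
      TensorNetwork.mem_rowDims.2 ⟨Finset.inl_mem_disjSum.2 he, inl_mem_ends_inl.2 hv,
        .inr ⟨_, inr_mem_ends_inl.2 ⟨he, rfl⟩, WithBot.bot_lt_coe _⟩⟩
    refine (hsize e he).trans (Nat.cast_le.2 ?_)
    exact Finset.single_le_prod' (f := (P.combined S).size)
      (fun i _ => (isProper_combined hS).size_pos i) hmem
  · refine (hrow x).trans (Nat.cast_le.2 ?_)
    have hrows : (∅ : Finset ED).disjSum (Finset.univ.filter fun f => x ∈ S.net.ends f ∧
        (f ∈ S.net.uncontracted ∨ ∃ y ∈ S.net.ends f, ord x < ord y)) ⊆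
        (P.combined S).rowDims (P.embeddingEdges EE) (dataFirst VD ord) (Sum.inr x) := by
      rintro (e | f) h
      · exact absurd (Finset.inl_mem_disjSum.1 h) (Finset.notMem_empty e)
      · obtain ⟨-, hx, hf⟩ := Finset.mem_filter.1 (Finset.inr_mem_disjSum.1 h)
        refine TensorNetwork.mem_rowDims.2 ⟨Finset.inr_mem_disjSum.2 (Finset.mem_univ f),
          inr_mem_ends_inr.2 hx, hf.imp inr_mem_uncontracted.2 ?_⟩
        exact fun ⟨y, hy, hlt⟩ => ⟨Sum.inr y, inr_mem_ends_inr.2 hy, WithBot.coe_lt_coe.2 hlt⟩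
    refine le_of_eq_of_le ?_ (Finset.prod_le_prod_of_subset_of_one_le' hrows
      fun i _ _ => (isProper_combined hS).size_pos i)
    rw [prod_size_disjSum, Finset.prod_empty, one_mul, Embedding.rowSize]

variable [Fintype VD] [Fintype ED] {TB : ContractionTree (VD ⊕ VE)}

theorem sum_dataTensors_le_two_mul_cost (hS : S.net.IsGraph) (hrow : ∀ x, b ≤ S.rowSize ord x)
    (hsize : ∀ e ∈ P.sketched, b ≤ P.net.size e)
    (hdata : ∀ v, ∃ e ∈ P.sketched, v ∈ P.net.ends e) (hTB : TB.IsFull) :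
    ∑ v, b * (∏ e ∈ P.net.edgesOut {v}, P.net.size e : ℕ) ≤ 2 * TB.cost (P.combined S) := by
  have hcost {v : VD} {B : Finset (VD ⊕ VE)} (h : Disjoint {Sum.inl v} B) (hB : B.Nonempty) :
      b * (∏ e ∈ P.net.edgesOut {v}, P.net.size e : ℕ) ≤
        (P.combined S).contractionCost {Sum.inl v} B := by
    have := (isProper_combined hS).mul_prod_le_contractionCost (isEdge_of_mem_embeddingEdges hS)
      (le_prod_rowDims hS hrow hsize hdata) (v := Sum.inl v) isMin_bot h hB
    rwa [edgesOut_singleton_inl hS, prod_size_disjSum, Finset.prod_empty, mul_one] at this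
  refine sum_leaves_le_two_mul_cost hTB.nodup Sum.inl_injective fun v _ => ?_
  have hne : {Sum.inl v} ≠ TB.verts := by
    obtain ⟨e, he, -⟩ := hdata v
    intro h
    have hmem : Sum.inr (S.attach ⟨e, he⟩) ∈ TB.verts := mem_verts.2 (hTB.mem_leaves _)
    rw [← h, Finset.mem_singleton] at hmem
    cases hmem
  obtain ⟨-, p, hp, hpv, -⟩ := exists_isParent (singleton_mem_nodes (hTB.mem_leaves _)) hne
  have hd := disjoint_of_mem_contractions hTB.nodup hp
  obtain ⟨hne₁, hne₂⟩ := nonempty_of_mem_contractions hp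
  refine ⟨p, hp, hpv, ?_⟩
  rcases hpv with h | h
  · rw [h] at hd ⊢
    exact hcost hd hne₂
  · rw [h] at hd ⊢
    rw [TensorNetwork.contractionCost_comm]
    exact hcost hd.symm hne₁

theorem sq_mul_unsketchedSize_le_contractionCost (hS : S.net.IsGraph) (hb : 0 ≤ b)
    (hrow : ∀ x, b ≤ S.rowSize ord x) (hsize : ∀ e ∈ P.sketched, b ≤ P.net.size e)
    (hdata : ∀ v, ∃ e ∈ P.sketched, v ∈ P.net.ends e) {A B : Finset (VD ⊕ VE)}
    (h : Disjoint A B) (hA : A.Nonempty) (hB : B.Nonempty) :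
    b ^ 2 * (P.unsketchedSize A.toLeft B.toLeft : ℝ) ≤ (P.combined S).contractionCost A B := by
  refine le_trans ?_ ((isProper_combined hS).sq_mul_prod_le_contractionCost
    (isEdge_of_mem_embeddingEdges hS) hb (le_prod_rowDims hS hrow hsize hdata) h hA hB)
  have hsub : ((P.net.edgesOut A.toLeft ∪ P.net.edgesOut B.toLeft) \ P.sketched).disjSum ∅ ⊆
      ((P.combined S).edgesOut A ∪ (P.combined S).edgesOut B) \ P.embeddingEdges EE := by
    rintro (e | f) h
    · obtain ⟨he, hs⟩ := Finset.mem_sdiff.1 (Finset.inl_mem_disjSum.1 h)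
      refine Finset.mem_sdiff.2 ⟨Finset.mem_union.2 ?_, fun h => hs (Finset.inl_mem_disjSum.1 h)⟩
      exact (Finset.mem_union.1 he).imp (inl_mem_edgesOut hS hs).2 (inl_mem_edgesOut hS hs).2
    · exact absurd (Finset.inr_mem_disjSum.1 h) (Finset.notMem_empty f)
  gcongr
  refine le_of_eq_of_le ?_ (Finset.prod_le_prod_of_subset_of_one_le' hsub
    fun i _ _ => (isProper_combined hS).size_pos i)
  rw [prod_size_disjSum, Finset.prod_empty, mul_one, unsketchedSize]

theorem sum_dataContractions_le_cost (hS : S.net.IsGraph) (hb : 0 ≤ b)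
    (hrow : ∀ x, b ≤ S.rowSize ord x) (hsize : ∀ e ∈ P.sketched, b ≤ P.net.size e)
    (hdata : ∀ v, ∃ e ∈ P.sketched, v ∈ P.net.ends e) (hTB : TB.IsFull)
    (hcon : TB.ConstrainedOn P.tree) :
    ∑ p ∈ P.tree.contractions.toFinset, b ^ 2 * (P.unsketchedSize p.1 p.2 : ℝ) ≤
      TB.cost (P.combined S) := by
  choose! q hq hqp using hcon
  have hunion {p : Finset VD × Finset VD} (hp : p ∈ P.tree.contractions) :
      (q p).1.toLeft ∪ (q p).2.toLeft = p.1 ∪ p.2 := by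
    rcases hqp p hp with ⟨h₁, h₂⟩ | ⟨h₁, h₂⟩
    · rw [h₁, h₂]
    · rw [h₁, h₂, Finset.union_comm]
  have hinj : Set.InjOn q P.tree.contractions.toFinset := fun p hp p' hp' h => by
    rw [SetLike.mem_coe, List.mem_toFinset] at hp hp'
    exact List.inj_on_of_nodup_map (nodup_map_union_contractions P.tree_full.nodup) hp hp'
      ((hunion hp).symm.trans (h ▸ hunion hp'))
  refine (Finset.sum_le_sum fun p hp => ?_).trans
    (sum_contractionCost_le_cost hTB.nodup (fun p hp => hq p (List.mem_toFinset.1 hp)) hinj)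
  rw [List.mem_toFinset] at hp
  obtain ⟨hne₁, hne₂⟩ := nonempty_of_mem_contractions (hq p hp)
  have hcost := sq_mul_unsketchedSize_le_contractionCost hS hb hrow hsize hdata
    (disjoint_of_mem_contractions hTB.nodup (hq p hp)) hne₁ hne₂
  rcases hqp p hp with ⟨h₁, h₂⟩ | ⟨h₁, h₂⟩
  · rwa [h₁, h₂] at hcost
  · rwa [h₁, h₂, unsketchedSize_comm] at hcost

theorem cost_treeSketch_le_mul_cost {m : ℕ} {κ : ℝ} (hm : 1 ≤ m) (hκ : 0 < κ)
    (hmp : ∀ p ∈ P.tree.contractions, m ≤ P.net.contractedSize p.1 p.2) (hS : S.net.IsGraph)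
    (hrow : ∀ x, m / κ ≤ S.rowSize ord x) (hsize : ∀ e ∈ P.sketched, m / κ ≤ P.net.size e)
    (hdata : ∀ v, ∃ e ∈ P.sketched, v ∈ P.net.ends e) (hTB : TB.IsFull)
    (hcon : TB.ConstrainedOn P.tree) :
    P.treeSketch.cost (P.combined (P.treeEmbedding m)) ≤
      2 * κ * (1 + κ) * TB.cost (P.combined S) := by
  calc P.treeSketch.cost (P.combined (P.treeEmbedding m))
      ≤ ∑ v, (m : ℝ) * (∏ e ∈ P.net.edgesOut {v}, P.net.size e : ℕ) +
          ∑ p ∈ P.tree.contractions.toFinset, 2 * (m ^ 2 * (P.unsketchedSize p.1 p.2 : ℝ)) :=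
        cost_treeSketch_le hm hmp
    _ = κ * ∑ v, m / κ * (∏ e ∈ P.net.edgesOut {v}, P.net.size e : ℕ) +
          2 * κ ^ 2 * ∑ p ∈ P.tree.contractions.toFinset,
            (m / κ) ^ 2 * (P.unsketchedSize p.1 p.2 : ℝ) := by
        rw [Finset.mul_sum, Finset.mul_sum]
        congr! 2
        · field_simp
        · field_simp
    _ ≤ κ * (2 * TB.cost (P.combined S)) + 2 * κ ^ 2 * TB.cost (P.combined S) := by
        gcongr
        · exact sum_dataTensors_le_two_mul_cost hS hrow hsize hdata hTB
        · exact sum_dataContractions_le_cost hS (by positivity) hrow hsize hdata hTB hcon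
    _ = 2 * κ * (1 + κ) * TB.cost (P.combined S) := by ring

end LowerBound

end SketchingInput

theorem log_one_div_div_sq_pos {ε δ : ℝ} (hε : ε ≠ 0) (hδ : 0 < δ) (hδ₁ : δ < 1) :
    0 < Real.log (1 / δ) / ε ^ 2 :=
  div_pos (Real.log_pos (one_lt_one_div hδ hδ₁)) (by positivity)

theorem div_le_of_sketchSize_bounds {c₀ c₁ c₂ m n nE K s : ℝ} (hc₀ : 0 < c₀) (hc₁ : 0 < c₁)
    (hc₂ : 0 < c₂) (hK : 0 ≤ K) (hm : m ≤ c₂ * ((2 * n - 1) * K)) (hs_ge : c₁ * (n * K) ≤ s)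
    (hs_le : s ≤ c₂ * (nE * K)) : m / (2 * c₂ ^ 2 / (c₀ * c₁)) ≤ c₀ * (nE * K) := by
  rw [div_le_iff₀ (by positivity), mul_div_assoc', le_div_iff₀ (by positivity)]
  calc m * (c₀ * c₁) ≤ c₂ * ((2 * n - 1) * K) * (c₀ * c₁) := by gcongr
    _ ≤ c₂ * (2 * n * K) * (c₀ * c₁) := by gcongr; linarith
    _ = 2 * c₀ * c₂ * (c₁ * (n * K)) := by ring
    _ ≤ 2 * c₀ * c₂ * (c₂ * (nE * K)) :=
        mul_le_mul_of_nonneg_left (hs_ge.trans hs_le) (by positivity)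
    _ = c₀ * (nE * K) * (2 * c₂ ^ 2) := by ring

theorem one_le_two_mul_sq_div {c₀ c₁ c₂ : ℝ} (hc₀ : 0 < c₀) (hc₀₁ : c₀ ≤ c₁) (hc₁₂ : c₁ ≤ c₂) :
    1 ≤ 2 * c₂ ^ 2 / (c₀ * c₁) := by
  have hc₁ : 0 < c₁ := hc₀.trans_le hc₀₁
  rw [one_le_div (by positivity)]
  calc c₀ * c₁ ≤ c₂ * c₂ := mul_le_mul (hc₀₁.trans hc₁₂) hc₁₂ hc₁.le (hc₁.le.trans hc₁₂)
    _ ≤ 2 * c₂ ^ 2 := by linarith [sq_nonneg c₂, sq c₂]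

theorem theorem4p4_general {VD ED : Type*} [Fintype VD] [DecidableEq VD] [Fintype ED]
    [DecidableEq ED] {P : SketchingInput VD ED} {c₀ c₁ c₂ ε δ : ℝ} {m : ℕ}
    (hc₀ : 0 < c₀) (hc₀₁ : c₀ ≤ c₁) (hε : 0 < ε) (hδ : 0 < δ) (hδ₁ : δ < 1)
    (hm_ge : c₁ * ((2 * Fintype.card VD - 1) * (Real.log (1 / δ) / ε ^ 2)) ≤ m)
    (hm_le : m ≤ c₂ * ((2 * Fintype.card VD - 1) * (Real.log (1 / δ) / ε ^ 2)))
    (hsize : ∀ e ∈ P.sketched, m ≤ P.net.size e)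
    (hdata : ∀ v : VD, ∃ e ∈ P.sketched, v ∈ P.net.ends e)
    (hmp : ∀ p ∈ P.tree.contractions, m ≤ P.net.contractedSize p.1 p.2) :
    (Fintype.card P.TreeNode = 2 * Fintype.card VD - 1 ∧
      (P.treeEmbedding m).IsTree ∧
      (P.treeEmbedding m).IsAdmissible c₀ c₁ c₂ ε δ ∧
      (P.treeEmbedding m).sketchSize = m ∧
      P.treeSketch.IsFull ∧
      P.treeSketch.ConstrainedOn P.tree) ∧
    ∀ (VE EE : Type*) [Fintype VE] [DecidableEq VE] [Fintype EE] [DecidableEq EE]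
      (S : Embedding P.sketched VE EE) (TB : ContractionTree (VD ⊕ VE)),
      S.net.IsGraph →
      (∃ ord : VE ≃ Fin (Fintype.card VE), ∀ x,
        c₀ * (Fintype.card VE * (Real.log (1 / δ) / ε ^ 2)) ≤ S.rowSize ord x) →
      c₁ * (Fintype.card VD * (Real.log (1 / δ) / ε ^ 2)) ≤ S.sketchSize →
      S.sketchSize ≤ c₂ * (Fintype.card VE * (Real.log (1 / δ) / ε ^ 2)) →
      TB.IsFull →
      TB.ConstrainedOn P.tree →
      P.treeSketch.cost (P.combined (P.treeEmbedding m)) ≤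
        2 * (2 * c₂ ^ 2 / (c₀ * c₁)) * (1 + 2 * c₂ ^ 2 / (c₀ * c₁)) * TB.cost (P.combined S) := by
  have hK := log_one_div_div_sq_pos hε.ne' hδ hδ₁
  have hnodes := P.card_treeNode_add_one
  have hN : (1 : ℝ) ≤ Fintype.card VD := by exact_mod_cast (by lia : 1 ≤ Fintype.card VD)
  have hNK : 0 < (2 * Fintype.card VD - 1) * (Real.log (1 / δ) / ε ^ 2) :=
    mul_pos (by linarith) hK
  have hc₁ : 0 < c₁ := hc₀.trans_le hc₀₁
  have hc₁₂ : c₁ ≤ c₂ := le_of_mul_le_mul_right (hm_ge.trans hm_le) hNK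
  have hm : 1 ≤ m := Nat.cast_pos.1 ((mul_pos hc₁ hNK).trans_le hm_ge)
  have hκ := one_le_two_mul_sq_div hc₀ hc₀₁ hc₁₂
  refine ⟨⟨by lia, SketchingInput.isTree_treeEmbedding hm,
    SketchingInput.isAdmissible_treeEmbedding hm hc₀₁ hK.le
      (by rwa [P.cast_card_treeNode]) (by rwa [P.cast_card_treeNode]),
    SketchingInput.sketchSize_treeEmbedding, SketchingInput.isFull_treeSketch,
    ContractionTree.constrainedOn_sketch⟩, ?_⟩
  rintro VE EE _ _ _ _ S TB hS ⟨ord, hrow⟩ hs_ge hs_le hTB hcon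
  refine SketchingInput.cost_treeSketch_le_mul_cost (ord := ord) hm (one_pos.trans_le hκ) hmp hS
    (fun x => ?_) (fun e he => ?_) hdata hTB hcon
  · exact (div_le_of_sketchSize_bounds hc₀ hc₁ (hc₁.trans_le hc₁₂) hK.le hm_le hs_ge hs_le).trans
      (hrow x)
  · exact (div_le_self m.cast_nonneg hκ).trans (Nat.cast_le.2 (hsize e he))

theorem theorem4p4 (c₀ c₁ c₂ : ℝ) (hc₀ : 0 < c₀) (hc₀₁ : c₀ ≤ c₁) (hc₁₂ : c₁ ≤ c₂) :
    ∃ C : ℝ, 0 < C ∧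
      ∀ (VD ED : Type*) [Fintype VD] [DecidableEq VD] [Fintype ED] [DecidableEq ED]
        (P : SketchingInput VD ED) (ε δ : ℝ) (m : ℕ),
        0 < ε → 0 < δ → δ < 1 →
        -- the sketch size of the tree embedding, which has `2 N - 1` tensors
        c₁ * ((2 * Fintype.card VD - 1) * (Real.log (1 / δ) / ε ^ 2)) ≤ m →
        m ≤ c₂ * ((2 * Fintype.card VD - 1) * (Real.log (1 / δ) / ε ^ 2)) →
        -- each dimension to be sketched is larger than the sketch size
        (∀ e ∈ P.sketched, m < P.net.size e) →
        -- each data tensor is adjacent to an edge to be sketched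
        (∀ v : VD, ∃ e ∈ P.sketched, v ∈ P.net.ends e) →
        -- each contraction of the data tree contracts dimensions of total size at least `m`
        (∀ p ∈ P.tree.contractions, m ≤ P.net.contractedSize p.1 p.2) →
        -- the tree embedding and its contraction tree are feasible
        (Fintype.card P.TreeNode = 2 * Fintype.card VD - 1 ∧
          (P.treeEmbedding m).IsTree ∧
          (P.treeEmbedding m).IsAdmissible c₀ c₁ c₂ ε δ ∧
          (P.treeEmbedding m).sketchSize = m ∧
          P.treeSketch.IsFull ∧
          P.treeSketch.ConstrainedOn P.tree) ∧
        -- and their cost is optimal up to the factor `C`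
        ∀ (VE EE : Type*) [Fintype VE] [DecidableEq VE] [Fintype EE] [DecidableEq EE]
          (S : Embedding P.sketched VE EE) (TB : ContractionTree (VD ⊕ VE)),
          S.IsAdmissible c₀ c₁ c₂ ε δ →
          c₁ * (Fintype.card VD * (Real.log (1 / δ) / ε ^ 2)) ≤ S.sketchSize →
          TB.IsFull →
          TB.ConstrainedOn P.tree →
          P.treeSketch.cost (P.combined (P.treeEmbedding m)) ≤ C * TB.cost (P.combined S) := by
  have hc₁ : 0 < c₁ := hc₀.trans_le hc₀₁
  have hc₂ : 0 < c₂ := hc₁.trans_le hc₁₂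
  refine ⟨2 * (2 * c₂ ^ 2 / (c₀ * c₁)) * (1 + 2 * c₂ ^ 2 / (c₀ * c₁)), by positivity, ?_⟩
  intro VD ED _ _ _ _ P ε δ m hε hδ hδ₁ hm_ge hm_le hsize hdata hmp
  refine (theorem4p4_general hc₀ hc₀₁ hε hδ hδ₁ hm_ge hm_le (fun e he => (hsize e he).le) hdata
    hmp).imp_right fun hopt VE EE _ _ _ _ S TB hS hs_ge hTB hcon => ?_
  exact hopt VE EE S TB hS.graph hS.linearization hs_ge hS.sketchSize_le hTB hcon
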